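/- All graphs are finite and undirected, with loops and multiple edges allowed. A \emph{graph parameter} is a real-valued function $f$ on graphs that is invariant under isomorphism. For a graph $G=(V,E)$ and $i,j\in V$, let $G+ij$ be $G$ with one new edge added between $i$ and $j$, and let $\Delta^G_{ij}=f(G+ij)-f(G)$. Call $f$ \emph{additive} if $f(G)=f(G_1)+f(G_2)$ whenever $G$ is the vertex-disjoint union of $G_1$ and $G_2$; \emph{Lipschitz with constant $\kappa$} if $|\Delta^G_{ij}|\le\kappa$ for all $G=(V,E)$ and $i,j\in V$; and \emph{concave} if for every $G=(V,E)$ and every $x\in\mathbb R^V$ with $\sum_{i\in V}x_i=0$ one has $\sum_{(i,j)\in V\times V}\Delta^G_{ij}x_ix_j\le 0$. Given a finite set $V$ and $d\colon V\to\mathbb N$ (where $0\in\mathbb N$), attach $d(i)$ half-edges to each $i\in V$. A matching is a set of pairwise disjoint $2$-element subsets of the set of half-edges. The configuration model $\mathbb G_d$ is the random graph on $V$ obtained by choosing a maximal matching uniformly at random and turning each of its pairs into an edge between the corresponding end-points. Let $\mathcal P_1(\mathbb N)$ be the set of probability measures $\mu$ on $\mathbb N$ with finite mean $\overline\mu$,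 with the Wasserstein distance $\mathcal W(\mu,\mu')=\sum_{i=1}^\infty\bigl|\sum_{k=i}^\infty(\mu(k)-\mu'(k))\bigr|$. \textbf{Theorem.} Let $f$ be an additive, concave graph parameter that is Lipschitz with constant $\kappa$. There is a function $\Psi\colon\mathcal P_1(\mathbb N)\to\mathbb R$ with the following properties. (1) Let $\mu\in\mathcal P_1(\mathbb N)$ and let $d_n\colon\{1,\dots,n\}\to\mathbb N$ ($n\ge1$) satisfy $$\frac1n\sum_{i=1}^n\mathbf 1_{\{d_n(i)=k\}}\xrightarrow[n\to\infty]{}\mu(k)\quad\text{for every }k\in\mathbb N,\qquad \frac1n\sum_{i=1}^n d_n(i)\xrightarrow[n\to\infty]{}\overline\mu.$$ Then for any random graphs $\mathbb G_{d_n}$ ($n\ge 1$) defined on a common probability space, each $\mathbb G_{d_n}$ being distributed as the configuration model with degrees $d_n$ (with an arbitrary joint law), almost surely $$\frac{f(\mathbb G_{d_n})}{n}\xrightarrow[n\to\infty]{}\Psi(\mu).$$ (2) For all $\mu,\mu'\in\mathcal P_1(\mathbb N)$, $|\Psi(\mu)-\Psi(\mu')|\le 2\kappa\,\mathcal W(\mu,\mu')$.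 (3) For all $\mu,\mu'\in\mathcal P_1(\mathbb N)$ and $0\le\theta\le1$, $\theta\Psi(\mu)+(1-\theta)\Psi(\mu')\le\Psi(\theta\mu+(1-\theta)\mu')$. -/

import Mathlib

open MeasureTheory ProbabilityTheory Filter Topology

noncomputable section

/-- An undirected graph on the vertex set `V`, with loops and multiple edges allowed: the multiset
of its edges, an edge being an unordered pair of (possibly equal) vertices. -/
@[ext]
structure Multigraph (V : Type) where
  /-- The edges, counted with multiplicity. -/
  edges : Multiset (Sym2 V)

namespace Multigraph

variable {V W : Type}

/-- Random graphs on a fixed vertex set are discrete random variables. -/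
instance : MeasurableSpace (Multigraph V) := ⊤

/-- The image of a graph under a map of the vertices. -/
def map (e : V → W) (G : Multigraph V) : Multigraph W :=
  ⟨G.edges.map (Sym2.map e)⟩

/-- `G + ij`: the graph `G` with one new edge between `i` and `j` (a loop if `i = j`). -/
def addEdge (G : Multigraph V) (i j : V) : Multigraph V :=
  ⟨s(i, j) ::ₘ G.edges⟩

/-- The vertex-disjoint union of two graphs. -/
def disjUnion (G : Multigraph V) (H : Multigraph W) : Multigraph (V ⊕ W) :=
  ⟨(G.map Sum.inl).edges + (H.map Sum.inr).edges⟩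

end Multigraph

/-- A graph parameter: a real-valued function of finite graphs, invariant under isomorphism. -/
structure GraphParameter where
  /-- The value of the parameter at a finite graph. -/
  val : ∀ {V : Type} [Finite V], Multigraph V → ℝ
  /-- Isomorphic graphs have the same value. -/
  val_iso : ∀ {V W : Type} [Finite V] [Finite W] (e : V ≃ W) (G : Multigraph V),
    val (G.map e) = val G

namespace GraphParameter

/-- The increment `f (G + ij) - f G`. -/
def incr (f : GraphParameter) {V : Type} [Finite V] (G : Multigraph V) (i j : V) : ℝ :=
  f.val (G.addEdge i j) - f.val G

/-- `f` is additive over vertex-disjoint unions. -/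
def IsAdditive (f : GraphParameter) : Prop :=
  ∀ {V W : Type} [Finite V] [Finite W] (G : Multigraph V) (H : Multigraph W),
    f.val (G.disjUnion H) = f.val G + f.val H

/-- `f` is Lipschitz with constant `κ`: adding one edge changes `f` by at most `κ`. -/
def IsLipschitz (f : GraphParameter) (κ : ℝ) : Prop :=
  ∀ {V : Type} [Finite V] (G : Multigraph V) (i j : V), |f.incr G i j| ≤ κ

/-- `f` is concave: every increment matrix is conditionally negative semidefinite. -/
def IsConcave (f : GraphParameter) : Prop :=
  ∀ {V : Type} [Fintype V] (G : Multigraph V) (x : V → ℝ), ∑ i, x i = 0 →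
    ∑ i, ∑ j, f.incr G i j * x i * x j ≤ 0

end GraphParameter

section ConfigurationModel

variable {V : Type}

/-- The half-edges: `d i` of them are attached to each vertex `i`. -/
abbrev HalfEdge (d : V → ℕ) : Type := Σ i : V, Fin (d i)

/-- A (partial) matching of a set `H`: a collection of pairwise disjoint pairs of distinct elements
of `H`. -/
def IsPartialMatching {H : Type} (m : Finset (Sym2 H)) : Prop :=
  (∀ e ∈ m, ¬ e.IsDiag) ∧ ∀ e ∈ m, ∀ e' ∈ m, ∀ h, h ∈ e → h ∈ e' → e = e'

/-- The graph induced by a collection of pairs of half-edges: every pair becomes an edge between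
the corresponding end-points. -/
def inducedGraph (d : V → ℕ) (m : Finset (Sym2 (HalfEdge d))) : Multigraph V :=
  ⟨m.val.map (Sym2.map Sigma.fst)⟩

/-- The (finite) set of all maximal matchings of the half-edges. -/
def maximalMatchings [Finite V] (d : V → ℕ) : Finset (Finset (Sym2 (HalfEdge d))) :=
  (Set.toFinite {m : Finset (Sym2 (HalfEdge d)) | Maximal IsPartialMatching m}).toFinset

theorem maximalMatchings_nonempty [Finite V] (d : V → ℕ) : (maximalMatchings d).Nonempty := by
  have hne : {m : Finset (Sym2 (HalfEdge d)) | IsPartialMatching m}.Nonempty :=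
    ⟨∅, by simp [IsPartialMatching]⟩
  obtain ⟨m, hm⟩ := (Set.toFinite _).exists_maximal hne
  exact ⟨m, by simpa [maximalMatchings] using hm⟩

/-- The configuration model with degrees `d`: the law of the graph induced by a uniformly chosen
maximal matching of the half-edges. -/
def configurationModel [Finite V] (d : V → ℕ) : PMF (Multigraph V) :=
  (PMF.uniformOfFinset (maximalMatchings d) (maximalMatchings_nonempty d)).map (inducedGraph d)

end ConfigurationModel

/-- `P₁(ℕ)`: the probability measures on `ℕ` with finite mean. -/
abbrev P1 : Type :=
  {μ : ProbabilityMeasure ℕ // Integrable (fun k : ℕ => (k : ℝ)) (μ : Measure ℕ)}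

namespace P1

/-- The mass `μ(k)`. -/
def mass (μ : P1) (k : ℕ) : ℝ := (μ.1 : Measure ℕ).real {k}

/-- The mean of `μ`. -/
def mean (μ : P1) : ℝ := ∫ k : ℕ, (k : ℝ) ∂(μ.1 : Measure ℕ)

/-- The Wasserstein distance `∑_{i ≥ 1} |∑_{k ≥ i} (μ(k) - μ'(k))|`. -/
def wasserstein (μ μ' : P1) : ℝ :=
  ∑' i : ℕ, |∑' k : ℕ, (μ.mass (i + 1 + k) - μ'.mass (i + 1 + k))|

/-- The mixture `θ μ + (1 - θ) μ'`, for `0 ≤ θ ≤ 1`. -/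
def mix (θ : ℝ) (hθ : θ ∈ Set.Icc (0 : ℝ) 1) (μ μ' : P1) : P1 :=
  ⟨⟨ENNReal.ofReal θ • (μ.1 : Measure ℕ) + ENNReal.ofReal (1 - θ) • (μ'.1 : Measure ℕ), ⟨by
      simp [← ENNReal.ofReal_add hθ.1 (sub_nonneg.2 hθ.2)]⟩⟩,
    (μ.2.smul_measure ENNReal.ofReal_ne_top).add_measure
      (μ'.2.smul_measure ENNReal.ofReal_ne_top)⟩

end P1

/-- The degree sequences `d n` (on `n` vertices) approach `μ`: for every `k` the proportion of
vertices of degree `k` tends to `μ(k)`, and the average degree tends to the mean of `μ`. -/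
def Approaches (d : ∀ n : ℕ, Fin n → ℕ) (μ : P1) : Prop :=
  (∀ k : ℕ, Tendsto (fun n : ℕ => (∑ i, if d n i = k then (1 : ℝ) else 0) / n) atTop
    (𝓝 (μ.mass k))) ∧
  Tendsto (fun n : ℕ => (∑ i, (d n i : ℝ)) / n) atTop (𝓝 μ.mean)

end

/-! The configuration model is a uniformly random matching of the half-edges that leaves at most one
of them free. Its mean value is therefore the average of `f` over all permutations of one fixed full
matching (`matchAvg_eq_expect_perm`). Three properties of this mean carry the theorem.

Stability. Changing the degrees by a total amount D moves the mean by at most 2κD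
(`abs_matchAvg_sub_le`, `abs_meanVal_sub_le_sum`). Once both degree sequences are sorted, D is the
ℓ¹ distance between their tail counts (`sum_abs_sub_eq_norm`), and on measures the same distance is
`wasserstein`. Everything is thus encoded by tail sequences in ℓ¹, where `Approaches` becomes norm
convergence by Scheffé's lemma.

Almost superadditivity. When two blocks are matched jointly rather than separately, the mean drops
by at most κ(εN + C), where N counts the half-edges of the second block only, ε > 0 is arbitrary and
C depends on ε (`meanVal_add_le`, `exists_concat`). This is an interpolation. After averaging over
the permutations of each block, adding a pair of free points changes the value by an amount that
depends only on their blocks. Concavity, tested on the uniform weight on the free points of one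
block minus that of the other, shows that a crossing pair is worth at least the mean of the two
kinds of inner pair, up to O(κ/K) when both blocks have order K free points. Crossing pairs are then
traded for inner ones one at a time; the imbalance of the free points behaves like a simple random
walk, and a quadratic potential controls it (`sub_potential_le`).

Concentration. A transposition of half-edges changes at most two pairs, so exponential moments are
bounded by revealing a random permutation one value at a time (`expect_exp_perm_fin_le`).

A Fekete argument with many copies of a fixed block yields the limit of the normalized means.
Stability makes it independent of the degree sequences and gives (2); concatenating blocks of
proportions θ and 1 - θ gives (3); concentration and Borel–Cantelli give (1). -/

noncomputable section

open scoped Classical BigOperators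

/-! ### Matchings as multisets of pairs, and averages over full matchings -/

section Matchings

variable {H K : Type}

/-- The image of a multiset of pairs under a map of the points. -/
def mapPairs (φ : H → K) (P : Multiset (Sym2 H)) : Multiset (Sym2 K) := P.map (Sym2.map φ)

/-- The multiset of end-points of a multiset of pairs. -/
def ends (P : Multiset (Sym2 H)) : Multiset H := P.bind Sym2.toMultiset

/-- A multiset of pairs is a matching when no point is used twice. -/
def IsMatching (P : Multiset (Sym2 H)) : Prop := (ends P).Nodup

@[simp] theorem mapPairs_zero (φ : H → K) : mapPairs φ 0 = 0 := rfl

@[simp] theorem mapPairs_cons (φ : H → K) (e : Sym2 H) (P : Multiset (Sym2 H)) :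
    mapPairs φ (e ::ₘ P) = Sym2.map φ e ::ₘ mapPairs φ P := Multiset.map_cons _ _ _

@[simp] theorem mapPairs_add (φ : H → K) (P Q : Multiset (Sym2 H)) :
    mapPairs φ (P + Q) = mapPairs φ P + mapPairs φ Q := Multiset.map_add _ _ _

@[simp] theorem card_mapPairs (φ : H → K) (P : Multiset (Sym2 H)) :
    (mapPairs φ P).card = P.card := Multiset.card_map _ _

theorem mapPairs_mapPairs {L : Type} (ψ : K → L) (φ : H → K) (P : Multiset (Sym2 H)) :
    mapPairs ψ (mapPairs φ P) = mapPairs (ψ ∘ φ) P := by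
  simp [mapPairs, Sym2.map_map]

@[simp] theorem mapPairs_id (P : Multiset (Sym2 H)) : mapPairs id P = P := by
  simp [mapPairs]

@[simp] theorem ends_zero : ends (0 : Multiset (Sym2 H)) = 0 := rfl

theorem toMultiset_mk (a b : H) : s(a, b).toMultiset = a ::ₘ b ::ₘ 0 := rfl

@[simp] theorem ends_cons (e : Sym2 H) (P : Multiset (Sym2 H)) :
    ends (e ::ₘ P) = e.toMultiset + ends P := Multiset.cons_bind _ _ _

@[simp] theorem ends_add (P Q : Multiset (Sym2 H)) : ends (P + Q) = ends P + ends Q :=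
  Multiset.add_bind _ _ _

theorem mem_ends {P : Multiset (Sym2 H)} {h : H} : h ∈ ends P ↔ ∃ e ∈ P, h ∈ e := by
  simp [ends]

theorem toMultiset_map (φ : H → K) (e : Sym2 H) :
    (Sym2.map φ e).toMultiset = e.toMultiset.map φ := by
  induction e with | _ a b => rfl

theorem ends_mapPairs (φ : H → K) (P : Multiset (Sym2 H)) :
    ends (mapPairs φ P) = (ends P).map φ := by
  induction P using Multiset.induction with
  | empty => rfl
  | cons e P ih => simp [ih, toMultiset_map]

theorem card_ends (P : Multiset (Sym2 H)) : (ends P).card = 2 * P.card := by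
  induction P using Multiset.induction with
  | empty => rfl
  | cons e P ih => simp [ih, Sym2.card_toMultiset]; ring

theorem mapPairs_congr {φ ψ : H → K} {P : Multiset (Sym2 H)} (h : ∀ x ∈ ends P, φ x = ψ x) :
    mapPairs φ P = mapPairs ψ P :=
  Multiset.map_congr rfl fun e he => Sym2.map_congr fun x hx => h x (mem_ends.2 ⟨e, he, hx⟩)

theorem IsMatching.mono {P Q : Multiset (Sym2 H)} (hQ : IsMatching Q) (h : P ≤ Q) :
    IsMatching P := by
  obtain ⟨R, rfl⟩ := Multiset.le_iff_exists_add.1 h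
  exact Multiset.nodup_of_le (by simp) hQ

theorem IsMatching.map {P : Multiset (Sym2 H)} (hP : IsMatching P) {φ : H → K}
    (hφ : Function.Injective φ) : IsMatching (mapPairs φ P) := by
  rw [IsMatching, ends_mapPairs]
  exact Multiset.Nodup.map hφ hP

theorem isMatching_zero : IsMatching (0 : Multiset (Sym2 H)) := Multiset.nodup_zero

theorem isMatching_mk_cons {P : Multiset (Sym2 H)} {a b : H} :
    IsMatching (s(a, b) ::ₘ P) ↔ a ≠ b ∧ a ∉ ends P ∧ b ∉ ends P ∧ IsMatching P := by
  simp [IsMatching, toMultiset_mk, not_or]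
  tauto

theorem IsMatching.nodup {P : Multiset (Sym2 H)} (hP : IsMatching P) : P.Nodup := by
  induction P using Multiset.induction with
  | empty => exact Multiset.nodup_zero
  | cons e P ih =>
    induction e with | _ a b =>
    obtain ⟨-, ha, -, hP⟩ := isMatching_mk_cons.1 hP
    exact Multiset.nodup_cons.2 ⟨fun h => ha (mem_ends.2 ⟨_, h, by simp⟩), ih hP⟩

theorem isMatching_iff {m : Finset (Sym2 H)} : IsMatching m.val ↔ IsPartialMatching m := by
  induction m using Finset.induction_on with
  | empty => simp [isMatching_zero, IsPartialMatching]
  | insert e m he ih =>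
    rw [Finset.insert_val_of_notMem he]
    induction e with | _ a b =>
    rw [isMatching_mk_cons, ih]
    simp only [mem_ends, Finset.mem_val, IsPartialMatching, Finset.mem_insert]
    constructor
    · rintro ⟨hab, ha, hb, h1, h2⟩
      push Not at ha hb
      refine ⟨?_, ?_⟩
      · rintro e (rfl | h)
        · simpa using hab
        · exact h1 e h
      · rintro e (rfl | h) e' (rfl | h') x hx hx'
        · rfl
        · rcases Sym2.mem_iff.1 hx with rfl | rfl
          · exact (ha _ h' hx').elim
          · exact (hb _ h' hx').elim
        · rcases Sym2.mem_iff.1 hx' with rfl | rfl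
          · exact (ha _ h hx).elim
          · exact (hb _ h hx).elim
        · exact h2 e h e' h' x hx hx'
    · rintro ⟨h1, h2⟩
      refine ⟨by simpa using h1 _ (Or.inl rfl), ?_, ?_, fun e h => h1 e (Or.inr h),
        fun e h e' h' => h2 e (Or.inr h) e' (Or.inr h')⟩
      · rintro ⟨e, h, h'⟩
        exact he (h2 _ (Or.inl rfl) e (Or.inr h) a (by simp) h' ▸ h)
      · rintro ⟨e, h, h'⟩
        exact he (h2 _ (Or.inl rfl) e (Or.inr h) b (by simp) h' ▸ h)

theorem mapPairs_equiv_symm (σ : H ≃ K) (P : Multiset (Sym2 H)) :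
    mapPairs σ.symm (mapPairs σ P) = P := by
  rw [mapPairs_mapPairs]; simp

/-- Transitivity of the symmetric group on matchings of a given size: this is what turns uniform
matchings into uniform permutations. -/
theorem exists_perm_of_card_eq {P Q : Multiset (Sym2 H)} (hP : IsMatching P) (hQ : IsMatching Q)
    (h : P.card = Q.card) : ∃ σ : Equiv.Perm H, mapPairs σ P = Q := by
  induction P using Multiset.induction generalizing Q with
  | empty => exact ⟨1, (Multiset.card_eq_zero.1 (by simpa using h.symm)).symm⟩
  | cons e P ih =>
    obtain ⟨e', Q, rfl⟩ : ∃ e' Q', Q = e' ::ₘ Q' := by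
      obtain ⟨e', he'⟩ := Multiset.card_pos_iff_exists_mem.1 (by rw [← h]; simp : 0 < Q.card)
      exact ⟨e', Multiset.exists_cons_of_mem he'⟩
    induction e with | _ a b =>
    induction e' with | _ a' b' =>
    rw [isMatching_mk_cons] at hP hQ
    obtain ⟨σ, rfl⟩ := ih hP.2.2.2 hQ.2.2.2 (by simpa using h)
    have hmem : ∀ x, x ∉ ends P → σ x ∉ ends (mapPairs σ P) := fun x hx => by
      simpa [ends_mapPairs] using hx
    have ha := hmem a hP.2.1
    have hb := hmem b hP.2.2.1
    have hab : σ a ≠ σ b := fun h => hP.1 (σ.injective h)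
    obtain ⟨hab', ha', hb', -⟩ := hQ
    -- Two transpositions correct `σ`: `t` brings `σ a` to `a'`, and a second one brings `t (σ b)`
    -- to `b'` without moving `a'`. Both fix the end-points that are already in place.
    set t := Equiv.swap (σ a) a' with ht
    refine ⟨Equiv.swap (t (σ b)) b' * t * σ, ?_⟩
    have hta : t (σ a) = a' := by simp [ht]
    have htb : t (σ b) ≠ a' := fun h => hab (t.injective (hta.trans h.symm))
    have hfix : ∀ x ∈ ends (mapPairs σ P), (Equiv.swap (t (σ b)) b' * t) x = x := by
      intro x hx
      have h1 : x ≠ σ a := fun h => ha (h ▸ hx)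
      have h2 : x ≠ σ b := fun h => hb (h ▸ hx)
      have h3 : x ≠ a' := fun h => ha' (h ▸ hx)
      have h4 : x ≠ b' := fun h => hb' (h ▸ hx)
      have htx : t x = x := Equiv.swap_apply_of_ne_of_ne h1 h3
      have : x ≠ t (σ b) := fun h => h2 (t.injective (htx.trans h))
      rw [Equiv.Perm.mul_apply, htx, Equiv.swap_apply_of_ne_of_ne this h4]
    rw [mapPairs_cons]
    congr 1
    · simp [hta, Equiv.swap_apply_of_ne_of_ne htb.symm hab']
    · have := mapPairs_congr (P := mapPairs σ P) (φ := ⇑(Equiv.swap (t (σ b)) b' * t)) (ψ := id) hfix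
      rw [mapPairs_id, mapPairs_mapPairs] at this
      simpa using this

variable [Fintype H] [Fintype K]

theorem IsMatching.two_mul_card_le {P : Multiset (Sym2 H)} (hP : IsMatching P) :
    2 * P.card ≤ Fintype.card H := by
  rw [← card_ends, ← Multiset.toFinset_card_of_nodup hP]
  exact Finset.card_le_univ _

/-- Matchings that leave at most one point unmatched. -/
def IsFull (P : Multiset (Sym2 H)) : Prop := IsMatching P ∧ Fintype.card H ≤ 2 * P.card + 1

theorem IsFull.card_eq {P Q : Multiset (Sym2 H)} (hP : IsFull P) (hQ : IsFull Q) :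
    P.card = Q.card := by
  have := hP.1.two_mul_card_le
  have := hQ.1.two_mul_card_le
  have := hP.2
  have := hQ.2
  lia

theorem IsFull.map {P : Multiset (Sym2 H)} (hP : IsFull P) (σ : H ≃ K) :
    IsFull (mapPairs σ P) :=
  ⟨hP.1.map σ.injective, by rw [card_mapPairs, ← Fintype.card_congr σ]; exact hP.2⟩

/-- The points that a multiset of pairs leaves unmatched. -/
def unmatched (P : Multiset (Sym2 H)) : Finset H := Finset.univ \ (ends P).toFinset

theorem mem_unmatched {P : Multiset (Sym2 H)} {h : H} : h ∈ unmatched P ↔ h ∉ ends P := by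
  simp [unmatched]

theorem IsMatching.card_unmatched {P : Multiset (Sym2 H)} (hP : IsMatching P) :
    (unmatched P).card + 2 * P.card = Fintype.card H := by
  rw [unmatched, Finset.card_sdiff_of_subset (Finset.subset_univ _),
    Multiset.toFinset_card_of_nodup hP, card_ends, Finset.card_univ]
  exact Nat.sub_add_cancel hP.two_mul_card_le

theorem IsMatching.exists_cons {P : Multiset (Sym2 H)} (hP : IsMatching P)
    (h : 2 * P.card + 2 ≤ Fintype.card H) : ∃ a b, IsMatching (s(a, b) ::ₘ P) := by
  have := hP.card_unmatched
  obtain ⟨a, ha, b, hb, hab⟩ := Finset.one_lt_card.1 (by lia : 1 < (unmatched P).card)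
  exact ⟨a, b, isMatching_mk_cons.2 ⟨hab, mem_unmatched.1 ha, mem_unmatched.1 hb, hP⟩⟩

theorem IsMatching.exists_full_ge {P : Multiset (Sym2 H)} (hP : IsMatching P) :
    ∃ Q, P ≤ Q ∧ IsFull Q := by
  induction hn : Fintype.card H - 2 * P.card using Nat.strong_induction_on generalizing P with
  | _ n ih =>
    by_cases h : 2 * P.card + 2 ≤ Fintype.card H
    · obtain ⟨a, b, hab⟩ := hP.exists_cons h
      obtain ⟨Q, hQ, hf⟩ := ih _ (by rw [← hn]; simp; lia) hab rfl
      exact ⟨Q, (Multiset.le_cons_self _ _).trans hQ, hf⟩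
    · exact ⟨P, le_rfl, hP, by lia⟩

/-- Two free points could always be paired, so maximality amounts to leaving at most one point free.
-/
theorem maximal_isPartialMatching_iff {m : Finset (Sym2 H)} :
    Maximal IsPartialMatching m ↔ IsFull m.val := by
  constructor
  · intro h
    have hm := isMatching_iff.2 h.1
    obtain ⟨Q, hQ, hf⟩ := hm.exists_full_ge
    have hle : m ≤ ⟨Q, hf.1.nodup⟩ := Finset.val_le_iff.1 hQ
    have := h.eq_of_le (isMatching_iff.1 hf.1) hle
    rw [this]; exact hf
  · intro h
    refine ⟨isMatching_iff.1 h.1, fun m' hm' hle => ?_⟩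
    have h1 := (isMatching_iff.2 hm').two_mul_card_le
    have h2 := h.2
    simp only [Finset.card_val] at h1 h2
    exact (Finset.eq_of_subset_of_card_le hle (by lia)).ge

variable (H) in
/-- The finite set of all full matchings. -/
def fullMatchings : Finset (Finset (Sym2 H)) := Finset.univ.filter fun m => IsFull m.val

theorem mem_fullMatchings {m : Finset (Sym2 H)} : m ∈ fullMatchings H ↔ IsFull m.val := by
  simp [fullMatchings]

theorem fullMatchings_nonempty : (fullMatchings H).Nonempty := by
  obtain ⟨Q, -, hQ⟩ := (isMatching_zero (H := H)).exists_full_ge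
  exact ⟨⟨Q, hQ.1.nodup⟩, mem_fullMatchings.2 hQ⟩

/-- The average of a function over all full matchings. -/
def matchAvg (g : Multiset (Sym2 H) → ℝ) : ℝ := 𝔼 m ∈ fullMatchings H, g m.val

theorem matchAvg_comp_perm (g : Multiset (Sym2 H) → ℝ) (σ : Equiv.Perm H) :
    matchAvg (fun P => g (mapPairs σ P)) = matchAvg g := by
  have hinj : ∀ τ : Equiv.Perm H, Function.Injective (Sym2.map τ) := fun τ =>
    Sym2.map.injective τ.injective
  refine Finset.expect_nbij' (fun m => m.map ⟨_, hinj σ⟩) (fun m => m.map ⟨_, hinj σ.symm⟩)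
    (fun m hm => ?_) (fun m hm => ?_) (fun m _ => ?_) (fun m _ => ?_) (fun m _ => rfl)
  · exact mem_fullMatchings.2 ((mem_fullMatchings.1 hm).map σ)
  · exact mem_fullMatchings.2 ((mem_fullMatchings.1 hm).map σ.symm)
  · exact Finset.val_injective (mapPairs_equiv_symm σ m.val)
  · exact Finset.val_injective (mapPairs_equiv_symm σ.symm m.val)

/-- Averaging over permutations does not change `matchAvg`, and after exchanging the two averages
the inner one is the same for every full matching, by transitivity. -/
theorem matchAvg_eq_expect_perm (g : Multiset (Sym2 H) → ℝ) {P : Multiset (Sym2 H)}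
    (hP : IsFull P) : matchAvg g = 𝔼 σ : Equiv.Perm H, g (mapPairs σ P) := by
  have key : ∀ Q, IsFull Q →
      𝔼 σ : Equiv.Perm H, g (mapPairs σ Q) = 𝔼 σ : Equiv.Perm H, g (mapPairs σ P) := by
    intro Q hQ
    obtain ⟨τ, rfl⟩ := exists_perm_of_card_eq hP.1 hQ.1 (hP.card_eq hQ)
    refine Fintype.expect_equiv (Equiv.mulRight τ) _ _ fun σ => ?_
    rw [mapPairs_mapPairs]; rfl
  calc matchAvg g = 𝔼 σ : Equiv.Perm H, matchAvg (fun Q => g (mapPairs σ Q)) := by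
        simp only [matchAvg_comp_perm]
        exact (Fintype.expect_const _).symm
    _ = 𝔼 m ∈ fullMatchings H, 𝔼 σ : Equiv.Perm H, g (mapPairs σ m.val) :=
        Finset.expect_comm _ _ _
    _ = 𝔼 m ∈ fullMatchings H, 𝔼 σ : Equiv.Perm H, g (mapPairs σ P) :=
        Finset.expect_congr rfl fun m hm => key _ (mem_fullMatchings.1 hm)
    _ = _ := Finset.expect_const fullMatchings_nonempty _

end Matchings

/-! ### Stability of the average when points are added -/

section Lipschitz

variable {H K : Type}

/-- Adding one pair changes `g` by at most `κ`. -/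
def IsPairLipschitz (κ : ℝ) (g : Multiset (Sym2 H) → ℝ) : Prop :=
  ∀ e P, |g (e ::ₘ P) - g P| ≤ κ

theorem IsPairLipschitz.abs_sub_le {κ : ℝ} {g : Multiset (Sym2 H) → ℝ} (hg : IsPairLipschitz κ g)
    {P Q : Multiset (Sym2 H)} (h : P ≤ Q) : |g Q - g P| ≤ κ * (Q.card - P.card) := by
  obtain ⟨R, rfl⟩ := Multiset.le_iff_exists_add.1 h
  clear h
  induction R using Multiset.induction with
  | empty => simp
  | cons e R ih =>
    have := hg e (P + R)
    rw [Multiset.add_cons]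
    calc |g (e ::ₘ (P + R)) - g P| ≤ |g (e ::ₘ (P + R)) - g (P + R)| + |g (P + R) - g P| :=
          _root_.abs_sub_le _ _ _
      _ ≤ κ + κ * ((P + R).card - P.card) := add_le_add this ih
      _ = _ := by simp; ring

theorem IsPairLipschitz.comp_mapPairs {κ : ℝ} {g : Multiset (Sym2 K) → ℝ}
    (hg : IsPairLipschitz κ g) (φ : H → K) : IsPairLipschitz κ fun P => g (mapPairs φ P) := by
  intro e P
  simpa using hg _ _

/-- The pairs that avoid a given set of points. -/
def avoiding (S : Finset H) (P : Multiset (Sym2 H)) : Multiset (Sym2 H) :=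
  P.filter fun e => ∀ x ∈ e, x ∉ S

theorem avoiding_le (S : Finset H) (P : Multiset (Sym2 H)) : avoiding S P ≤ P :=
  Multiset.filter_le _ _

theorem notMem_of_mem_ends_avoiding {S : Finset H} {P : Multiset (Sym2 H)} {x : H}
    (hx : x ∈ ends (avoiding S P)) : x ∉ S := by
  obtain ⟨e, he, hxe⟩ := mem_ends.1 hx
  exact (Multiset.mem_filter.1 he).2 x hxe

/-- Each discarded pair uses a point of `S`, and disjoint pairs use different ones. -/
theorem IsMatching.card_le_card_avoiding_add {P : Multiset (Sym2 H)} (hP : IsMatching P)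
    (S : Finset H) : P.card ≤ (avoiding S P).card + S.card := by
  set Q := P.filter fun e => ¬ ∀ x ∈ e, x ∉ S with hQ
  have hsplit : (avoiding S P).card + Q.card = P.card := by
    rw [← Multiset.card_add, avoiding, hQ, Multiset.filter_add_not]
  have hQm : IsMatching Q := hP.mono (Multiset.filter_le _ _)
  have hcount : ∀ R : Multiset (Sym2 H), (∀ e ∈ R, ∃ x ∈ e, x ∈ S) →
      R.card ≤ ((ends R).filter (· ∈ S)).card := by
    intro R
    induction R using Multiset.induction with
    | empty => simp
    | cons e R ih =>
      intro h
      have h1 := ih fun e he => h e (Multiset.mem_cons_of_mem he)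
      obtain ⟨x, hx, hxS⟩ := h e (Multiset.mem_cons_self _ _)
      have h2 : 0 < (e.toMultiset.filter (· ∈ S)).card :=
        Multiset.card_pos_iff_exists_mem.2 ⟨x, by simp [hx, hxS]⟩
      rw [ends_cons, Multiset.filter_add, Multiset.card_add, Multiset.card_cons]
      lia
  have h1 := hcount Q (by
    intro e he
    simpa using (Multiset.mem_filter.1 he).2)
  have h2 : ((ends Q).filter (· ∈ S)).card ≤ S.card := by
    refine Multiset.card_le_card ((Multiset.le_iff_subset (hQm.filter _)).2 ?_)
    intro x hx
    exact (Multiset.mem_filter.1 hx).2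
  lia

theorem exists_mapPairs_eq {ι : H → K} (P : Multiset (Sym2 K))
    (h : ∀ x ∈ ends P, x ∈ Set.range ι) : ∃ Q, mapPairs ι Q = P := by
  induction P using Multiset.induction with
  | empty => exact ⟨0, rfl⟩
  | cons e P ih =>
    obtain ⟨Q, rfl⟩ := ih fun x hx => h x (by simp [hx])
    induction e with | _ a b =>
    obtain ⟨a, rfl⟩ := h a (by simp [toMultiset_mk])
    obtain ⟨b, rfl⟩ := h b (by simp [toMultiset_mk])
    exact ⟨s(a, b) ::ₘ Q, by simp⟩

theorem IsMatching.of_mapPairs {φ : H → K} {P : Multiset (Sym2 H)}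
    (h : IsMatching (mapPairs φ P)) : IsMatching P := by
  rw [IsMatching, ends_mapPairs] at h
  exact h.of_map

variable [Fintype H] [Fintype K]

/-- Drop the pairs that meet the complement of the range of `ι`, pull the rest back to `H`, and
complete. The matching `Q` does not depend on `g`, which the averaging argument needs. -/
theorem IsFull.exists_full_near {κ : ℝ} (hκ : 0 ≤ κ) {ι : H → K} (hι : Function.Injective ι)
    {P : Multiset (Sym2 K)} (hP : IsFull P) :
    ∃ Q : Multiset (Sym2 H), IsFull Q ∧ ∀ g : Multiset (Sym2 K) → ℝ, IsPairLipschitz κ g →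
      |g P - g (mapPairs ι Q)| ≤ 2 * κ * (Fintype.card K - Fintype.card H) := by
  set S : Finset K := Finset.univ \ Finset.univ.image ι with hS
  have hle : Fintype.card H ≤ Fintype.card K := Fintype.card_le_of_injective ι hι
  have hScard : S.card = Fintype.card K - Fintype.card H := by
    rw [hS, Finset.card_sdiff_of_subset (Finset.subset_univ _), Finset.card_image_of_injective _ hι]
    rfl
  obtain ⟨Q₀, hQ₀⟩ := exists_mapPairs_eq (ι := ι) (avoiding S P) fun x hx => by
    simpa [hS] using notMem_of_mem_ends_avoiding hx
  have hQm : IsMatching Q₀ := IsMatching.of_mapPairs (φ := ι) (hQ₀ ▸ hP.1.mono (avoiding_le S P))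
  obtain ⟨Q, hQ₀Q, hQ⟩ := hQm.exists_full_ge
  refine ⟨Q, hQ, fun g hg => ?_⟩
  have h1 := hg.abs_sub_le (avoiding_le S P)
  have h2 := (hg.comp_mapPairs ι).abs_sub_le hQ₀Q
  rw [hQ₀] at h2
  have hc : (avoiding S P).card = Q₀.card := by rw [← hQ₀, card_mapPairs]
  have h3 := hP.1.card_le_card_avoiding_add S
  have h4 := hP.2
  have h5 := hQ.1.two_mul_card_le
  have h6 := Multiset.card_le_card (avoiding_le S P)
  have h7 := Multiset.card_le_card hQ₀Q
  -- Deletions plus insertions number at most twice the difference of the cardinalities. The point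
  -- that `P` may leave free costs nothing extra, because the counts are integers.
  have h8 : P.card + Q.card + 2 * Fintype.card H ≤ 2 * Q₀.card + 2 * Fintype.card K := by lia
  have h9 : (P.card : ℝ) + Q.card + 2 * Fintype.card H ≤ 2 * Q₀.card + 2 * Fintype.card K := by
    exact_mod_cast h8
  rw [abs_le] at *
  rw [hc] at h1
  constructor <;> nlinarith

/-- A coupling: permutations of `H` extended to `K` write both averages over the same pairs of a
full matching of `K` and a permutation of `H`, with nearby matchings in each term. -/
theorem abs_matchAvg_sub_le {κ : ℝ} (hκ : 0 ≤ κ) {ι : H → K} (hι : Function.Injective ι)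
    {g : Multiset (Sym2 K) → ℝ} (hg : IsPairLipschitz κ g) :
    |matchAvg g - matchAvg fun P => g (mapPairs ι P)| ≤
      2 * κ * (Fintype.card K - Fintype.card H) := by
  choose! q hq hqg using fun (P : Multiset (Sym2 K)) (hP : IsFull P) =>
    hP.exists_full_near hκ hι
  let lift : Equiv.Perm H → Equiv.Perm K := fun σ => σ.viaFintypeEmbedding ⟨ι, hι⟩
  have hlift : ∀ (σ : Equiv.Perm H) P, mapPairs (lift σ) (mapPairs ι P) =
      mapPairs ι (mapPairs σ P) := by
    intro σ P
    rw [mapPairs_mapPairs, mapPairs_mapPairs]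
    congr 1
    funext x
    exact σ.viaFintypeEmbedding_apply_image ⟨ι, hι⟩ x
  have e1 : matchAvg g = 𝔼 m ∈ fullMatchings K, 𝔼 σ : Equiv.Perm H, g (mapPairs (lift σ) m.val) := by
    calc matchAvg g = 𝔼 σ : Equiv.Perm H, matchAvg (fun P => g (mapPairs (lift σ) P)) := by
          simp only [matchAvg_comp_perm]
          exact (Fintype.expect_const _).symm
      _ = _ := Finset.expect_comm _ _ _
  have e2 : matchAvg (fun P => g (mapPairs ι P)) =
      𝔼 m ∈ fullMatchings K, 𝔼 σ : Equiv.Perm H, g (mapPairs (lift σ) (mapPairs ι (q m.val))) := by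
    rw [← Finset.expect_const (fullMatchings_nonempty (H := K))
      (matchAvg fun P => g (mapPairs ι P))]
    refine Finset.expect_congr rfl fun m hm => ?_
    rw [matchAvg_eq_expect_perm _ (hq _ (mem_fullMatchings.1 hm))]
    simp only [hlift]
  rw [e1, e2, ← Finset.expect_sub_distrib]
  refine (Finset.abs_expect_le _ _).trans (Finset.expect_le fullMatchings_nonempty fun m hm => ?_)
  rw [← Finset.expect_sub_distrib]
  refine (Finset.abs_expect_le _ _).trans
    (Finset.expect_le Finset.univ_nonempty fun σ _ => ?_)
  exact hqg _ (mem_fullMatchings.1 hm) _ (hg.comp_mapPairs _)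

end Lipschitz

/-! ### Exponential moments of functions of a random permutation -/

section Concentration

/-- The chord of the convex function exp over [-L, L]. Its slope term vanishes on averaging a
centred variable, which leaves the cosh. -/
theorem exp_mul_le_cosh_add {y L : ℝ} (hL : 0 < L) (hy : |y| ≤ L) (l : ℝ) :
    Real.exp (l * y) ≤ Real.cosh (l * L) + y / L * Real.sinh (l * L) := by
  rw [abs_le] at hy
  have h1 : 0 ≤ (1 + y / L) / 2 := by
    have : -1 ≤ y / L := by rw [le_div_iff₀ hL]; linarith
    linarith
  have h2 : 0 ≤ (1 - y / L) / 2 := by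
    have : y / L ≤ 1 := by rw [div_le_one₀ hL]; linarith
    linarith
  have h := convexOn_exp.2 (Set.mem_univ (l * L)) (Set.mem_univ (-(l * L))) h1 h2 (by ring)
  simp only [smul_eq_mul] at h
  have e : (1 + y / L) / 2 * (l * L) + (1 - y / L) / 2 * -(l * L) = l * y := by
    field_simp; ring
  rw [e] at h
  rw [Real.cosh_eq, Real.sinh_eq]
  linarith

theorem expect_exp_centered_le {ι : Type} [Fintype ι] [Nonempty ι] {X : ι → ℝ} {L : ℝ}
    (hL : 0 ≤ L) (hX : ∀ i j, |X i - X j| ≤ L) (l : ℝ) :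
    𝔼 i, Real.exp (l * (X i - 𝔼 j, X j)) ≤ Real.exp (l ^ 2 * L ^ 2 / 2) := by
  have hY : ∀ i, |X i - 𝔼 j, X j| ≤ L := by
    intro i
    rw [← Fintype.expect_const (ι := ι) (X i), ← Finset.expect_sub_distrib]
    exact (Finset.abs_expect_le _ _).trans
      (Finset.expect_le Finset.univ_nonempty fun j _ => hX i j)
  rcases hL.eq_or_lt with rfl | hL
  · have h0 : ∀ i, X i - 𝔼 j, X j = 0 := fun i => abs_nonpos_iff.1 (hY i)
    simp [h0]
  · have hmean : 𝔼 i, (X i - 𝔼 j, X j) = 0 := by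
      rw [Finset.expect_sub_distrib, Fintype.expect_const, sub_self]
    calc _ ≤ 𝔼 i, (Real.cosh (l * L) + (X i - 𝔼 j, X j) * (Real.sinh (l * L) / L)) :=
          Finset.expect_le_expect fun i _ => by
            refine (exp_mul_le_cosh_add hL (hY i) l).trans (le_of_eq ?_)
            ring
      _ = Real.cosh (l * L) := by
          rw [Finset.expect_add_distrib, Fintype.expect_const, ← Finset.expect_mul, hmean]
          simp
      _ ≤ _ := by
          rw [← mul_pow]
          exact Real.cosh_le_exp_half_sq _

/-- A transposition applied after the image of 0 is fixed is again a transposition of the whole set,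
so the increment bound is inherited in the induction. -/
theorem decomposeFin_symm_swap_mul {n : ℕ} (p : Fin (n + 1)) (i j : Fin n)
    (σ : Equiv.Perm (Fin n)) : Equiv.Perm.decomposeFin.symm (p, Equiv.swap i j * σ) =
      Equiv.swap (Equiv.swap 0 p i.succ) (Equiv.swap 0 p j.succ) *
        Equiv.Perm.decomposeFin.symm (p, σ) := by
  ext x : 1
  rw [Equiv.swap_apply_apply]
  refine Fin.cases ?_ (fun x => ?_) x
  · have h : Equiv.swap i.succ j.succ 0 = (0 : Fin (n + 1)) :=
      Equiv.swap_apply_of_ne_of_ne (Fin.succ_ne_zero _).symm (Fin.succ_ne_zero _).symm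
    simp [h]
  · simp [(Fin.succ_injective n).map_swap]

theorem decomposeFin_symm_change {n : ℕ} (p q : Fin (n + 1)) (σ : Equiv.Perm (Fin n)) :
    Equiv.Perm.decomposeFin.symm (q, σ) =
      Equiv.swap 0 q * (Equiv.swap 0 p * Equiv.Perm.decomposeFin.symm (p, σ)) := by
  ext x : 1
  refine Fin.cases ?_ (fun x => ?_) x <;> simp

theorem expect_decomposeFin {n : ℕ} (φ : Equiv.Perm (Fin (n + 1)) → ℝ) :
    𝔼 σ, φ σ = 𝔼 p, 𝔼 σ, φ (Equiv.Perm.decomposeFin.symm (p, σ)) := by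
  rw [← Finset.expect_product', Finset.univ_product_univ]
  exact Fintype.expect_equiv Equiv.Perm.decomposeFin _ _ fun σ => by simp

/-- The martingale method: condition on the image of 0. The conditional means lie within 2c of each
other, which costs a factor exp(2l²c²), and the remaining permutation is handled by induction. -/
theorem expect_exp_perm_fin_le {c : ℝ} (hc : 0 ≤ c) (l : ℝ) {n : ℕ}
    (φ : Equiv.Perm (Fin n) → ℝ) (hφ : ∀ i j σ, |φ (Equiv.swap i j * σ) - φ σ| ≤ c) :
    𝔼 σ, Real.exp (l * (φ σ - 𝔼 τ, φ τ)) ≤ Real.exp (n * (2 * l ^ 2 * c ^ 2)) := by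
  induction n with
  | zero => simp
  | succ n ih =>
    set ψ : Fin (n + 1) → Equiv.Perm (Fin n) → ℝ :=
      fun p σ => φ (Equiv.Perm.decomposeFin.symm (p, σ)) with hψ
    have hmean : 𝔼 τ, φ τ = 𝔼 p, 𝔼 σ, ψ p σ := expect_decomposeFin φ
    have hb : ∀ p q, |(𝔼 σ, ψ p σ) - 𝔼 σ, ψ q σ| ≤ 2 * c := by
      intro p q
      rw [← Finset.expect_sub_distrib]
      refine (Finset.abs_expect_le _ _).trans
        (Finset.expect_le Finset.univ_nonempty fun σ _ => ?_)
      simp only [hψ]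
      -- Changing the image of 0 amounts to two transpositions, hence 2c.
      rw [decomposeFin_symm_change q p]
      refine (abs_sub_le _ _ _).trans ((add_le_add (hφ _ _ _) (hφ _ _ _)).trans (by linarith))
    calc 𝔼 σ, Real.exp (l * (φ σ - 𝔼 τ, φ τ))
        = 𝔼 p, 𝔼 σ, Real.exp (l * (ψ p σ - 𝔼 p, 𝔼 σ, ψ p σ)) := by
          rw [expect_decomposeFin, hmean]
      _ = 𝔼 p, Real.exp (l * ((𝔼 σ, ψ p σ) - 𝔼 p, 𝔼 σ, ψ p σ)) *
            𝔼 σ, Real.exp (l * (ψ p σ - 𝔼 σ, ψ p σ)) := by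
          refine Finset.expect_congr rfl fun p _ => ?_
          rw [Finset.mul_expect]
          refine Finset.expect_congr rfl fun σ _ => ?_
          rw [← Real.exp_add]
          ring_nf
      _ ≤ 𝔼 p, Real.exp (l * ((𝔼 σ, ψ p σ) - 𝔼 p, 𝔼 σ, ψ p σ)) *
            Real.exp (n * (2 * l ^ 2 * c ^ 2)) := by
          refine Finset.expect_le_expect fun p _ => ?_
          refine mul_le_mul_of_nonneg_left (ih _ fun i j σ => ?_) (Real.exp_nonneg _)
          simp only [hψ]
          rw [decomposeFin_symm_swap_mul]
          exact hφ _ _ _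
      _ ≤ Real.exp (l ^ 2 * (2 * c) ^ 2 / 2) * Real.exp (n * (2 * l ^ 2 * c ^ 2)) := by
          rw [← Finset.expect_mul]
          exact mul_le_mul_of_nonneg_right (expect_exp_centered_le (by positivity) hb l)
            (Real.exp_nonneg _)
      _ = _ := by
          rw [← Real.exp_add]
          push_cast
          ring_nf

theorem expect_exp_perm_le {H : Type} [Fintype H] {c : ℝ} (hc : 0 ≤ c) (l : ℝ)
    (φ : Equiv.Perm H → ℝ) (hφ : ∀ i j σ, |φ (Equiv.swap i j * σ) - φ σ| ≤ c) :
    𝔼 σ, Real.exp (l * (φ σ - 𝔼 τ, φ τ)) ≤ Real.exp (Fintype.card H * (2 * l ^ 2 * c ^ 2)) := by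
  let e := Fintype.equivFin H
  have hmul : ∀ σ τ, e.symm.permCongr (σ * τ) = e.symm.permCongr σ * e.symm.permCongr τ := by
    intro σ τ; ext x; simp [Equiv.permCongr_apply]
  have hswap : ∀ i j, e.symm.permCongr (Equiv.swap i j) = Equiv.swap (e.symm i) (e.symm j) := by
    intro i j
    ext x
    simp only [Equiv.permCongr_apply, Equiv.symm_symm, Equiv.swap_apply_def, Equiv.eq_symm_apply]
    split_ifs <;> simp
  have hE : ∀ F : Equiv.Perm H → ℝ, 𝔼 σ, F σ = 𝔼 σ, F (e.symm.permCongr σ) := fun F =>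
    (Fintype.expect_equiv e.symm.permCongr _ _ fun σ => rfl).symm
  have := expect_exp_perm_fin_le hc l (fun σ => φ (e.symm.permCongr σ)) (fun i j σ => by
    rw [hmul, hswap]; exact hφ _ _ _)
  rwa [← hE φ, ← hE fun σ => Real.exp (l * (φ σ - 𝔼 τ, φ τ))] at this

/-- At most two pairs contain `x` or `y`. Removing them costs 2κ, and so does inserting their
images. -/
theorem IsMatching.abs_swap_sub_le {H : Type} {κ : ℝ} {g : Multiset (Sym2 H) → ℝ}
    (hg : IsPairLipschitz κ g) (hκ : 0 ≤ κ) {P : Multiset (Sym2 H)} (hP : IsMatching P) (x y : H) :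
    |g (mapPairs (Equiv.swap x y) P) - g P| ≤ 4 * κ := by
  set Q := avoiding {x, y} P
  have hfix : mapPairs (Equiv.swap x y) Q = Q := by
    conv_rhs => rw [← mapPairs_id Q]
    refine mapPairs_congr fun z hz => ?_
    have := notMem_of_mem_ends_avoiding hz
    simp only [Finset.mem_insert, Finset.mem_singleton, not_or] at this
    exact Equiv.swap_apply_of_ne_of_ne this.1 this.2
  have h1 := hg.abs_sub_le (avoiding_le {x, y} P)
  have h2 := (hg.comp_mapPairs (Equiv.swap x y)).abs_sub_le (avoiding_le {x, y} P)
  rw [hfix] at h2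
  have h3 : (P.card : ℝ) - Q.card ≤ 2 := by
    have := hP.card_le_card_avoiding_add {x, y}
    have h4 : ({x, y} : Finset H).card ≤ 2 := Finset.card_le_two
    have h5 : P.card ≤ Q.card + 2 := by lia
    have : (P.card : ℝ) ≤ Q.card + 2 := by exact_mod_cast h5
    linarith
  have h4 : κ * ((P.card : ℝ) - Q.card) ≤ κ * 2 := mul_le_mul_of_nonneg_left h3 hκ
  rw [abs_sub_comm] at h1
  refine (abs_sub_le _ (g Q) _).trans ((add_le_add h2 h1).trans (by linarith))

theorem matchAvg_exp_le {H : Type} [Fintype H] {κ : ℝ} {g : Multiset (Sym2 H) → ℝ}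
    (hg : IsPairLipschitz κ g) (hκ : 0 ≤ κ) (l : ℝ) :
    matchAvg (fun P => Real.exp (l * (g P - matchAvg g))) ≤
      Real.exp (Fintype.card H * (32 * l ^ 2 * κ ^ 2)) := by
  obtain ⟨P, -, hP⟩ := (isMatching_zero (H := H)).exists_full_ge
  rw [matchAvg_eq_expect_perm _ hP, matchAvg_eq_expect_perm _ hP]
  refine (expect_exp_perm_le (c := 4 * κ) (by positivity) l (fun σ => g (mapPairs σ P))
    fun i j σ => ?_).trans (le_of_eq (by ring_nf))
  have := IsMatching.abs_swap_sub_le hg hκ (hP.1.map σ.injective) i j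
  rwa [mapPairs_mapPairs] at this

end Concentration

/-! ### Concavity on blocks of interchangeable points -/

section Interpolation

/-- The matrices of increments of `g` are conditionally negative semidefinite. -/
def IsPairConcave {H : Type} [Fintype H] (g : Multiset (Sym2 H) → ℝ) : Prop :=
  ∀ (P : Multiset (Sym2 H)) (w : H → ℝ), ∑ h, w h = 0 →
    ∑ h, ∑ h', (g (s(h, h') ::ₘ P) - g P) * w h * w h' ≤ 0

section Blocks

variable {H : Type}

theorem sum_sum_indicator_mul [Fintype H] (D : H → H → ℝ) (S T : Finset H) (a b : ℝ) :
    ∑ h, ∑ h', D h h' * (if h ∈ S then a else 0) * (if h' ∈ T then b else 0) =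
      a * b * ∑ h ∈ S, ∑ h' ∈ T, D h h' := by
  simp only [mul_ite, ite_mul, mul_zero, zero_mul, Finset.sum_ite_mem, Finset.univ_inter]
  have : ∀ h, ∑ x ∈ T, (if h ∈ S then D h x * a * b else 0) =
      if h ∈ S then ∑ x ∈ T, D h x * a * b else 0 := fun h => by split_ifs <;> simp
  simp only [this, Finset.sum_ite_mem, Finset.univ_inter, Finset.mul_sum]
  exact Finset.sum_congr rfl fun h _ => Finset.sum_congr rfl fun h' _ => by ring

/-- Concavity sees the diagonal, where a point is paired with itself, but a matching never does. The
diagonal has weight 1/|S|, and its entries are only bounded below by -κ. -/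
theorem le_block_average {D : H → H → ℝ} {S : Finset H} (hS : S.Nonempty) {A κ : ℝ}
    (hoff : ∀ h ∈ S, ∀ h' ∈ S, h ≠ h' → D h h' = A) (hdiag : ∀ h ∈ S, -κ ≤ D h h) (hA : A ≤ κ) :
    A - 2 * κ / S.card ≤ (1 / S.card : ℝ) * (1 / S.card) * ∑ h ∈ S, ∑ h' ∈ S, D h h' := by
  have hpos : (0 : ℝ) < S.card := by exact_mod_cast hS.card_pos
  have hrow : ∀ h ∈ S, (S.card - 1) * A - κ ≤ ∑ h' ∈ S, D h h' := by
    intro h hh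
    rw [← Finset.add_sum_erase S _ hh, Finset.sum_congr rfl fun h' hh' =>
      hoff h hh h' (Finset.mem_of_mem_erase hh') (Finset.ne_of_mem_erase hh').symm,
      Finset.sum_const, Finset.card_erase_of_mem hh, nsmul_eq_mul,
      Nat.cast_sub hS.card_pos]
    have := hdiag h hh
    push_cast
    linarith
  have hsum := Finset.sum_le_sum hrow
  rw [Finset.sum_const, nsmul_eq_mul] at hsum
  have h1 : (1 / S.card : ℝ) * (1 / S.card) * (S.card * ((S.card - 1) * A - κ)) ≤
      (1 / S.card : ℝ) * (1 / S.card) * ∑ h ∈ S, ∑ h' ∈ S, D h h' :=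
    mul_le_mul_of_nonneg_left hsum (by positivity)
  refine le_trans ?_ h1
  have h2 : (1 / S.card : ℝ) * (1 / S.card) * (S.card * ((S.card - 1) * A - κ)) =
      A - (A + κ) / S.card := by
    field_simp; ring
  rw [h2]
  have : (A + κ) / S.card ≤ 2 * κ / S.card := by gcongr; linarith
  linarith

/-- The weight is uniform on `S` minus uniform on `T`. It has total zero, and the quadratic form
splits into the two inner averages minus the two crossing ones. -/
theorem add_le_two_mul_cross [Fintype H] {D : H → H → ℝ} {S T : Finset H} (hS : S.Nonempty)
    (hT : T.Nonempty) {A B X κ : ℝ}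
    (hconc : ∀ w : H → ℝ, ∑ h, w h = 0 → ∑ h, ∑ h', D h h' * w h * w h' ≤ 0)
    (hdiag : ∀ h, -κ ≤ D h h) (hA : A ≤ κ) (hB : B ≤ κ)
    (hSS : ∀ h ∈ S, ∀ h' ∈ S, h ≠ h' → D h h' = A) (hTT : ∀ h ∈ T, ∀ h' ∈ T, h ≠ h' → D h h' = B)
    (hST : ∀ h ∈ S, ∀ h' ∈ T, D h h' = X) (hTS : ∀ h ∈ T, ∀ h' ∈ S, D h h' = X) :
    A + B - 2 * κ * (1 / S.card + 1 / T.card) ≤ 2 * X := by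
  have hs : (0 : ℝ) < S.card := by exact_mod_cast hS.card_pos
  have ht : (0 : ℝ) < T.card := by exact_mod_cast hT.card_pos
  set u : H → ℝ := fun h => if h ∈ S then (1 / S.card : ℝ) else 0 with hu
  set v : H → ℝ := fun h => if h ∈ T then (1 / T.card : ℝ) else 0 with hv
  have h0 := hconc (fun h => u h - v h) (by
    simp only [hu, hv, Finset.sum_sub_distrib, Finset.sum_ite_mem, Finset.univ_inter,
      Finset.sum_const, nsmul_eq_mul]
    field_simp; ring)
  have hexp : ∑ h, ∑ h', D h h' * (u h - v h) * (u h' - v h') =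
      (∑ h, ∑ h', D h h' * u h * u h') - (∑ h, ∑ h', D h h' * u h * v h') -
      (∑ h, ∑ h', D h h' * v h * u h') + ∑ h, ∑ h', D h h' * v h * v h' := by
    simp only [← Finset.sum_sub_distrib, ← Finset.sum_add_distrib]
    exact Finset.sum_congr rfl fun h _ => Finset.sum_congr rfl fun h' _ => by ring
  rw [hexp] at h0
  simp only [hu, hv, sum_sum_indicator_mul] at h0
  have h1 := le_block_average hS hSS (fun h _ => hdiag h) hA
  have h2 := le_block_average hT hTT (fun h _ => hdiag h) hB
  have h3 : (1 / S.card : ℝ) * (1 / T.card) * ∑ h ∈ S, ∑ h' ∈ T, D h h' = X := by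
    rw [Finset.sum_congr rfl fun h hh => Finset.sum_congr rfl fun h' hh' => hST h hh h' hh']
    simp only [Finset.sum_const, nsmul_eq_mul]
    field_simp
  have h4 : (1 / T.card : ℝ) * (1 / S.card) * ∑ h ∈ T, ∑ h' ∈ S, D h h' = X := by
    rw [Finset.sum_congr rfl fun h hh => Finset.sum_congr rfl fun h' hh' => hTS h hh h' hh']
    simp only [Finset.sum_const, nsmul_eq_mul]
    field_simp
  rw [h3, h4] at h0
  have h5 : 2 * κ * (1 / S.card + 1 / T.card) = 2 * κ / S.card + 2 * κ / T.card := by ring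
  rw [h5]
  linarith

end Blocks

/-! ### Interpolation between a matching and its two monochromatic parts -/

section Colored

variable {H : Type} (χ : H → Bool)

/-- Invariance under the transpositions of two points of the same colour. -/
def IsColorInvariant (g : Multiset (Sym2 H) → ℝ) : Prop :=
  ∀ x y, χ x = χ y → ∀ P, g (mapPairs (Equiv.swap x y) P) = g P

/-- The number of pairs that join points of different colours. -/
def crossCount (P : Multiset (Sym2 H)) : ℕ := (mapPairs χ P).count s(true, false)

variable {χ}

/-- Swapping two free points leaves `P` unchanged, so only the colour of the new end-point matters.
-/
theorem IsColorInvariant.swap_cons {g : Multiset (Sym2 H) → ℝ} (hg : IsColorInvariant χ g)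
    {P : Multiset (Sym2 H)} {x y z : H} (hxy : χ x = χ y) (hx : x ∉ ends P) (hy : y ∉ ends P)
    (hzx : z ≠ x) (hzy : z ≠ y) : g (s(z, x) ::ₘ P) = g (s(z, y) ::ₘ P) := by
  rw [← hg x y hxy (s(z, x) ::ₘ P), mapPairs_cons]
  have : mapPairs (Equiv.swap x y) P = P := by
    conv_rhs => rw [← mapPairs_id P]
    refine mapPairs_congr fun w hw => Equiv.swap_apply_of_ne_of_ne ?_ ?_
    · rintro rfl; exact hx hw
    · rintro rfl; exact hy hw
  rw [this]
  simp [Equiv.swap_apply_of_ne_of_ne hzx hzy]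

theorem IsColorInvariant.cons_eq_cons {g : Multiset (Sym2 H) → ℝ} (hg : IsColorInvariant χ g)
    {P : Multiset (Sym2 H)} {S : Finset H} (hSP : ∀ x ∈ S, x ∉ ends P)
    (hS : ∀ x ∈ S, ∀ y ∈ S, χ x = χ y) {a b c d : H} (ha : a ∈ S) (hb : b ∈ S) (hc : c ∈ S)
    (hd : d ∈ S) (hab : a ≠ b) (hcd : c ≠ d) : g (s(a, b) ::ₘ P) = g (s(c, d) ::ₘ P) := by
  by_cases h : c = b
  · subst h
    rw [Sym2.eq_swap]
    exact hg.swap_cons (hS _ ha _ hd) (hSP _ ha) (hSP _ hd) hab.symm hcd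
  · rw [Sym2.eq_swap, hg.swap_cons (hS _ ha _ hc) (hSP _ ha) (hSP _ hc) hab.symm (Ne.symm h),
      Sym2.eq_swap]
    exact hg.swap_cons (hS _ hb _ hd) (hSP _ hb) (hSP _ hd) h hcd

theorem crossCount_cons (x y : H) (P : Multiset (Sym2 H)) :
    crossCount χ (s(x, y) ::ₘ P) = crossCount χ P + if χ x = χ y then 0 else 1 := by
  simp only [crossCount, mapPairs_cons, Sym2.map_mk, Multiset.count_cons]
  congr 1
  cases χ x <;> cases χ y <;> simp

theorem exists_eq_cons_of_crossCount_pos {P : Multiset (Sym2 H)} (h : 0 < crossCount χ P) :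
    ∃ x y P', χ x = true ∧ χ y = false ∧ P = s(x, y) ::ₘ P' := by
  obtain ⟨e, he, hχ⟩ := Multiset.mem_map.1 (Multiset.count_pos.1 h)
  obtain ⟨P', rfl⟩ := Multiset.exists_cons_of_mem he
  induction e with | _ x y =>
  rw [Sym2.map_mk, Sym2.eq_iff] at hχ
  rcases hχ with ⟨hx, hy⟩ | ⟨hx, hy⟩
  · exact ⟨x, y, P', hx, hy, rfl⟩
  · exact ⟨y, x, P', hy, hx, by rw [Sym2.eq_swap]⟩

theorem crossCount_le_count (P : Multiset (Sym2 H)) :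
    crossCount χ P ≤ ((ends P).map χ).count false := by
  induction P using Multiset.induction with
  | empty => simp [crossCount]
  | cons e P ih =>
    induction e with | _ x y =>
    rw [crossCount_cons, ends_cons, toMultiset_mk]
    simp only [Multiset.cons_add, Multiset.map_cons, zero_add, Multiset.count_cons]
    cases χ x <;> cases χ y <;> simp <;> lia

variable [Fintype H]

theorem IsColorInvariant.local_le_cross {g : Multiset (Sym2 H) → ℝ} (hg : IsColorInvariant χ g)
    {κ : ℝ} (hlip : IsPairLipschitz κ g) (hconc : IsPairConcave g)
    {P : Multiset (Sym2 H)} {S T : Finset H} (hSP : ∀ x ∈ S, x ∉ ends P)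
    (hTP : ∀ x ∈ T, x ∉ ends P) (hS : ∀ x ∈ S, χ x = true) (hT : ∀ x ∈ T, χ x = false)
    {a a' b b' x y : H} (ha : a ∈ S) (ha' : a' ∈ S) (haa' : a ≠ a') (hb : b ∈ T) (hb' : b' ∈ T)
    (hbb' : b ≠ b') (hx : x ∈ S) (hy : y ∈ T) :
    g (s(a, a') ::ₘ P) + g (s(b, b') ::ₘ P) - 2 * κ * (1 / S.card + 1 / T.card) ≤
      2 * g (s(x, y) ::ₘ P) := by
  have hS' : ∀ x ∈ S, ∀ y ∈ S, χ x = χ y := fun x hx y hy => by rw [hS x hx, hS y hy]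
  have hT' : ∀ x ∈ T, ∀ y ∈ T, χ x = χ y := fun x hx y hy => by rw [hT x hx, hT y hy]
  have hne : ∀ x ∈ S, ∀ y ∈ T, x ≠ y := by
    rintro x hx y hy rfl
    simpa [hS x hx] using hT x hy
  have hcross : ∀ h ∈ S, ∀ h' ∈ T, g (s(h, h') ::ₘ P) = g (s(x, y) ::ₘ P) := by
    intro h hh h' hh'
    rw [hg.swap_cons (hT' _ hh' _ hy) (hTP _ hh') (hTP _ hy) (hne _ hh _ hh') (hne _ hh _ hy),
      Sym2.eq_swap, hg.swap_cons (hS' _ hh _ hx) (hSP _ hh) (hSP _ hx) (hne _ hh _ hy).symm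
      (hne _ hx _ hy).symm, Sym2.eq_swap]
  have := add_le_two_mul_cross (D := fun h h' => g (s(h, h') ::ₘ P) - g P) ⟨a, ha⟩ ⟨b, hb⟩
    (A := g (s(a, a') ::ₘ P) - g P) (B := g (s(b, b') ::ₘ P) - g P)
    (X := g (s(x, y) ::ₘ P) - g P) (κ := κ) (hconc P) (fun h => (abs_le.1 (hlip _ _)).1)
    (abs_le.1 (hlip _ _)).2 (abs_le.1 (hlip _ _)).2
    (fun h hh h' hh' hn => by rw [hg.cons_eq_cons hSP hS' hh hh' ha ha' hn haa'])
    (fun h hh h' hh' hn => by rw [hg.cons_eq_cons hTP hT' hh hh' hb hb' hn hbb'])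
    (fun h hh h' hh' => by rw [hcross h hh h' hh'])
    (fun h hh h' hh' => by rw [Sym2.eq_swap, hcross h' hh' h hh])
  linarith

variable (χ) in
/-- The unmatched points of a given colour. -/
def unmatchedOf (b : Bool) (P : Multiset (Sym2 H)) : Finset H :=
  (unmatched P).filter fun h => χ h = b

theorem mem_unmatchedOf {b : Bool} {P : Multiset (Sym2 H)} {h : H} :
    h ∈ unmatchedOf χ b P ↔ h ∉ ends P ∧ χ h = b := by
  simp [unmatchedOf, mem_unmatched]

theorem IsMatching.card_unmatchedOf {P : Multiset (Sym2 H)} (hP : IsMatching P) (b : Bool) :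
    (unmatchedOf χ b P).card + ((ends P).map χ).count b =
      (Finset.univ.filter fun h => χ h = b).card := by
  have h1 : ((ends P).map χ).count b = ((ends P).toFinset.filter fun h => χ h = b).card := by
    rw [Multiset.count_map, Finset.card_def, Finset.filter_val, Multiset.toFinset_val,
      hP.dedup]
    congr 1
    exact Multiset.filter_congr fun x _ => eq_comm
  rw [h1, ← Finset.card_union_of_disjoint]
  · congr 1
    ext h
    simp only [Finset.mem_union, mem_unmatchedOf, Finset.mem_filter, Multiset.mem_toFinset,
      Finset.mem_univ, true_and]
    tauto
  · rw [Finset.disjoint_left]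
    intro h hh hh'
    exact (mem_unmatchedOf.1 hh).1 (by simpa using (Finset.mem_filter.1 hh').1)

theorem card_unmatchedOf_add (P : Multiset (Sym2 H)) :
    (unmatchedOf χ true P).card + (unmatchedOf χ false P).card = (unmatched P).card := by
  rw [← Finset.card_filter_add_card_filter_not (s := unmatched P) (fun h => χ h = true)]
  simp [unmatchedOf]

theorem card_unmatchedOf_cons {P : Multiset (Sym2 H)} {x y : H} (h : IsMatching (s(x, y) ::ₘ P))
    (b : Bool) : (unmatchedOf χ b P).card = (unmatchedOf χ b (s(x, y) ::ₘ P)).card +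
      (if χ x = b then 1 else 0) + (if χ y = b then 1 else 0) := by
  have h1 := h.card_unmatchedOf (χ := χ) b
  have h2 := (isMatching_mk_cons.1 h).2.2.2.card_unmatchedOf (χ := χ) b
  rw [ends_cons, toMultiset_mk] at h1
  simp only [Multiset.cons_add, Multiset.map_cons, zero_add, Multiset.count_cons] at h1
  simp only [@eq_comm _ b] at h1
  lia

variable {g : Multiset (Sym2 H) → ℝ} {κ L : ℝ}

/-- Free points are paired within their colour until each colour has at most one left, at a cost of
κ per pair. Here `L` is the value guaranteed once no such pair can be added. -/
theorem le_of_crossCount_eq_zero (hκ : 0 ≤ κ) (hlip : IsPairLipschitz κ g)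
    (hL : ∀ P, IsMatching P → crossCount χ P = 0 → (unmatchedOf χ true P).card ≤ 1 →
      (unmatchedOf χ false P).card ≤ 1 → L ≤ g P)
    {P : Multiset (Sym2 H)} (hP : IsMatching P) (hc : crossCount χ P = 0) :
    L - κ * (((unmatchedOf χ true P).card + (unmatchedOf χ false P).card : ℝ) / 2) ≤ g P := by
  induction hn : (unmatchedOf χ true P).card + (unmatchedOf χ false P).card
    using Nat.strong_induction_on generalizing P with
  | _ n ih =>
    by_cases h : ∃ b, 1 < (unmatchedOf χ b P).card
    · obtain ⟨b, hb⟩ := h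
      obtain ⟨x, hx, y, hy, hxy⟩ := Finset.one_lt_card.1 hb
      rw [mem_unmatchedOf] at hx hy
      have hm : IsMatching (s(x, y) ::ₘ P) := isMatching_mk_cons.2 ⟨hxy, hx.1, hy.1, hP⟩
      have h1 := card_unmatchedOf_cons (χ := χ) hm true
      have h2 := card_unmatchedOf_cons (χ := χ) hm false
      have h3 : (unmatchedOf χ true P).card + (unmatchedOf χ false P).card =
          (unmatchedOf χ true (s(x, y) ::ₘ P)).card +
            (unmatchedOf χ false (s(x, y) ::ₘ P)).card + 2 := by
        rw [h1, h2, hx.2, hy.2]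
        cases b <;> simp <;> lia
      have h4 := ih _ (by lia) hm (by rw [crossCount_cons, hc, hx.2, hy.2]; simp) rfl
      have h5 := (abs_le.1 (hlip s(x, y) P)).2
      have h6 : ((unmatchedOf χ true P).card : ℝ) + (unmatchedOf χ false P).card =
          (unmatchedOf χ true (s(x, y) ::ₘ P)).card +
            (unmatchedOf χ false (s(x, y) ::ₘ P)).card + 2 := by exact_mod_cast h3
      rw [h6]
      linarith
    · push Not at h
      have := hL P hP hc (h true) (h false)
      have : 0 ≤ κ * (((unmatchedOf χ true P).card + (unmatchedOf χ false P).card : ℝ) / 2) := by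
        positivity
      linarith

/-- The crude bound without concavity. Deleting a crossing pair costs κ and frees one point of each
colour, which adds another κ to the cost of completion. -/
theorem sub_le_of_crossCount (hκ : 0 ≤ κ) (hlip : IsPairLipschitz κ g)
    (hL : ∀ P, IsMatching P → crossCount χ P = 0 → (unmatchedOf χ true P).card ≤ 1 →
      (unmatchedOf χ false P).card ≤ 1 → L ≤ g P)
    {P : Multiset (Sym2 H)} (hP : IsMatching P) :
    L - κ * (2 * crossCount χ P +
      ((unmatchedOf χ true P).card + (unmatchedOf χ false P).card : ℝ) / 2) ≤ g P := by
  induction hn : crossCount χ P generalizing P with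
  | zero => simpa using le_of_crossCount_eq_zero hκ hlip hL hP hn
  | succ n ih =>
    obtain ⟨x, y, P, hx, hy, rfl⟩ := exists_eq_cons_of_crossCount_pos (by lia : 0 < crossCount χ P)
    have h1 := card_unmatchedOf_cons (χ := χ) hP true
    have h2 := card_unmatchedOf_cons (χ := χ) hP false
    have h3 := ih (isMatching_mk_cons.1 hP).2.2.2 (by
      rw [crossCount_cons, hx, hy] at hn; simpa using hn)
    have h4 := (abs_le.1 (hlip s(x, y) P)).1
    simp only [hx, hy, if_true, reduceCtorEq, if_false, add_zero] at h1 h2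
    rw [h1, h2] at h3
    push_cast at h3 ⊢
    linarith

/-- Each trade of a crossing pair for an inner one keeps the number `R` of free points and moves the
imbalance s - t by ±2. Hence (s - t)² + 4·`crossCount` is preserved on average, while each trade
loses at most 8κ/R as long as both colours have at least R/4 free points. The coefficient 8N/R²
makes the potential pay for the crude bound when the imbalance exceeds R/2. -/
theorem sub_potential_le (hg : IsColorInvariant χ g) (hκ : 0 ≤ κ) (hlip : IsPairLipschitz κ g)
    (hconc : IsPairConcave g)
    (hL : ∀ P, IsMatching P → crossCount χ P = 0 → (unmatchedOf χ true P).card ≤ 1 →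
      (unmatchedOf χ false P).card ≤ 1 → L ≤ g P)
    {N R : ℕ} (hR : 0 < R) {P : Multiset (Sym2 H)} (hP : IsMatching P)
    (hcN : crossCount χ P ≤ N)
    (hsum : (unmatchedOf χ true P).card + (unmatchedOf χ false P).card = R) :
    L - κ * (R / 2 + 8 / R * crossCount χ P + 8 * N / R ^ 2 *
      (((unmatchedOf χ true P).card - (unmatchedOf χ false P).card : ℝ) ^ 2 +
        4 * crossCount χ P)) ≤ g P := by
  have hR' : (0 : ℝ) < R := by exact_mod_cast hR
  induction hn : crossCount χ P generalizing P with
  | zero =>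
    have := le_of_crossCount_eq_zero hκ hlip hL hP hn
    have h1 : ((unmatchedOf χ true P).card : ℝ) + (unmatchedOf χ false P).card = R := by
      exact_mod_cast hsum
    rw [h1] at this
    refine le_trans ?_ this
    have h2 : 0 ≤ 8 * N / R ^ 2 *
      ((unmatchedOf χ true P).card - (unmatchedOf χ false P).card : ℝ) ^ 2 := by positivity
    have := mul_nonneg hκ h2
    simp only [Nat.cast_zero, mul_zero, add_zero]
    linarith
  | succ n ih =>
    set s : ℝ := ((unmatchedOf χ true P).card : ℝ) with hs
    set t : ℝ := ((unmatchedOf χ false P).card : ℝ) with ht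
    have hst : s + t = R := by rw [hs, ht]; exact_mod_cast hsum
    -- With a large imbalance one colour may have too few free points for concavity to help; the
    -- potential term is then at least 2N, enough for the crude bound.
    by_cases hD : (R : ℝ) ^ 2 / 4 < (s - t) ^ 2
    · have h1 := sub_le_of_crossCount hκ hlip hL hP
      rw [← hs, ← ht, hst] at h1
      refine le_trans ?_ h1
      refine sub_le_sub_left (mul_le_mul_of_nonneg_left ?_ hκ) _
      have h2 : (2 : ℝ) * N ≤ 8 * N / R ^ 2 * (s - t) ^ 2 := by
        calc (2 : ℝ) * N = 8 * N / R ^ 2 * (R ^ 2 / 4) := by field_simp; ring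
          _ ≤ _ := by gcongr
      have h3 : (crossCount χ P : ℝ) ≤ N := by exact_mod_cast hcN
      have h4 : (0 : ℝ) ≤ 8 / R * ((n + 1 : ℕ) : ℝ) := by positivity
      have h5 : (0 : ℝ) ≤ 8 * N / R ^ 2 * (4 * ((n + 1 : ℕ) : ℝ)) := by positivity
      rw [mul_add (8 * N / R ^ 2 : ℝ)]
      linarith
    · push Not at hD
      have hs4 : (R : ℝ) / 4 ≤ s := by nlinarith
      have ht4 : (R : ℝ) / 4 ≤ t := by nlinarith
      obtain ⟨x, y, P, hx, hy, rfl⟩ :=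
        exists_eq_cons_of_crossCount_pos (by lia : 0 < crossCount χ P)
      obtain ⟨hxy, hxP, hyP, hPm⟩ := isMatching_mk_cons.1 hP
      have h1 := card_unmatchedOf_cons (χ := χ) hP true
      have h2 := card_unmatchedOf_cons (χ := χ) hP false
      simp only [hx, hy, if_true, reduceCtorEq, if_false, add_zero] at h1 h2
      have hs1 : 0 < (unmatchedOf χ true (s(x, y) ::ₘ P)).card := by
        have : 0 < s := by linarith [div_pos hR' (by norm_num : (0 : ℝ) < 4)]
        rw [hs] at this; exact_mod_cast this
      have ht1 : 0 < (unmatchedOf χ false (s(x, y) ::ₘ P)).card := by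
        have : 0 < t := by linarith [div_pos hR' (by norm_num : (0 : ℝ) < 4)]
        rw [ht] at this; exact_mod_cast this
      obtain ⟨a, ha, a', ha', haa'⟩ := Finset.one_lt_card.1
        (by lia : 1 < (unmatchedOf χ true P).card)
      obtain ⟨b, hb, b', hb', hbb'⟩ := Finset.one_lt_card.1
        (by lia : 1 < (unmatchedOf χ false P).card)
      have hstep := hg.local_le_cross hlip hconc (fun z hz => (mem_unmatchedOf.1 hz).1)
        (fun z hz => (mem_unmatchedOf.1 hz).1) (fun z hz => (mem_unmatchedOf.1 hz).2)
        (fun z hz => (mem_unmatchedOf.1 hz).2) ha ha' haa' hb hb' hbb'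
        (mem_unmatchedOf.2 ⟨hxP, hx⟩) (mem_unmatchedOf.2 ⟨hyP, hy⟩)
      rw [mem_unmatchedOf] at ha ha' hb hb'
      have hcount : crossCount χ P = n := by
        rw [crossCount_cons, hx, hy] at hn; simpa using hn
      have hA : IsMatching (s(a, a') ::ₘ P) := isMatching_mk_cons.2 ⟨haa', ha.1, ha'.1, hPm⟩
      have hB : IsMatching (s(b, b') ::ₘ P) := isMatching_mk_cons.2 ⟨hbb', hb.1, hb'.1, hPm⟩
      have hA1 := card_unmatchedOf_cons (χ := χ) hA true
      have hA2 := card_unmatchedOf_cons (χ := χ) hA false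
      have hB1 := card_unmatchedOf_cons (χ := χ) hB true
      have hB2 := card_unmatchedOf_cons (χ := χ) hB false
      simp only [ha.2, ha'.2, hb.2, hb'.2, if_true, reduceCtorEq, if_false, add_zero]
        at hA1 hA2 hB1 hB2
      have hAc : crossCount χ (s(a, a') ::ₘ P) = n := by
        rw [crossCount_cons, ha.2, ha'.2, hcount]; simp
      have hBc : crossCount χ (s(b, b') ::ₘ P) = n := by
        rw [crossCount_cons, hb.2, hb'.2, hcount]; simp
      have ihA := ih hA (by lia) (by lia) hAc
      have ihB := ih hB (by lia) (by lia) hBc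
      have eA1 : ((unmatchedOf χ true (s(a, a') ::ₘ P)).card : ℝ) = s - 1 := by
        rw [hs, eq_sub_iff_add_eq]; exact_mod_cast (by lia)
      have eA2 : ((unmatchedOf χ false (s(a, a') ::ₘ P)).card : ℝ) = t + 1 := by
        rw [ht]; exact_mod_cast (by lia)
      have eB1 : ((unmatchedOf χ true (s(b, b') ::ₘ P)).card : ℝ) = s + 1 := by
        rw [hs]; exact_mod_cast (by lia)
      have eB2 : ((unmatchedOf χ false (s(b, b') ::ₘ P)).card : ℝ) = t - 1 := by
        rw [ht, eq_sub_iff_add_eq]; exact_mod_cast (by lia)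
      rw [eA1, eA2] at ihA
      rw [eB1, eB2] at ihB
      have e1 : ((unmatchedOf χ true P).card : ℝ) = s + 1 := by
        rw [hs]; exact_mod_cast h1
      have e2 : ((unmatchedOf χ false P).card : ℝ) = t + 1 := by
        rw [ht]; exact_mod_cast h2
      rw [e1, e2] at hstep
      have hr1 : 1 / (s + 1) ≤ 4 / R := by
        rw [div_le_div_iff₀ (by linarith) hR']; linarith
      have hr2 : 1 / (t + 1) ≤ 4 / R := by
        rw [div_le_div_iff₀ (by linarith) hR']; linarith
      have hr : κ * (1 / (s + 1) + 1 / (t + 1)) ≤ κ * (8 / R) := by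
        refine mul_le_mul_of_nonneg_left ?_ hκ
        have : (8 : ℝ) / R = 4 / R + 4 / R := by ring
        linarith
      push_cast
      set M : ℝ := 8 * N / R ^ 2
      -- The martingale identity for the potential, averaged over the two inner replacements.
      have key : (M * ((s - 1 - (t + 1)) ^ 2 + 4 * n) + M * ((s + 1 - (t - 1)) ^ 2 + 4 * n)) =
          2 * (M * ((s - t) ^ 2 + 4 * (n + 1))) := by ring
      have key' := congrArg (κ * ·) key
      linarith

theorem exists_remove_cross {P : Multiset (Sym2 H)} (hP : IsMatching P) {k : ℕ}
    (hk : k ≤ crossCount χ P) : ∃ Q ≤ P, P.card = Q.card + k ∧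
      crossCount χ P = crossCount χ Q + k ∧
      ∀ b, (unmatchedOf χ b Q).card = (unmatchedOf χ b P).card + k := by
  induction k with
  | zero => exact ⟨P, le_rfl, by simp⟩
  | succ k ih =>
    obtain ⟨Q, hQP, h1, h2, h3⟩ := ih (by lia)
    obtain ⟨x, y, Q, hx, hy, rfl⟩ :=
      exists_eq_cons_of_crossCount_pos (by lia : 0 < crossCount χ Q)
    refine ⟨Q, (Multiset.le_cons_self _ _).trans hQP, ?_, ?_, fun b => ?_⟩
    · rw [h1]; simp; ring
    · rw [h2, crossCount_cons, hx, hy]; simp; ring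
    · have := h3 b
      have h4 := card_unmatchedOf_cons (χ := χ) (hP.mono hQP) b
      rw [hx, hy] at h4
      cases b <;> simp at h4 <;> lia

/-- The error made by one interpolation between `H` and a block of `N` half-edges, when `K`
half-edges of each side are left aside. -/
def interpolationError (N K : ℕ) : ℝ :=
  2 * K + 1 + 4 * N / K + 2 * N * (1 + 4 * N) / K ^ 2

/-- A full matching has no room for the block argument, so `K` crossing pairs are first removed.
This leaves 2K or 2K + 1 free points with imbalance at most 1. With fewer than `K` crossing pairs
the crude bound suffices. -/
theorem sub_interpolationError_le (hg : IsColorInvariant χ g) (hκ : 0 ≤ κ)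
    (hlip : IsPairLipschitz κ g) (hconc : IsPairConcave g)
    (hL : ∀ P, IsMatching P → crossCount χ P = 0 → (unmatchedOf χ true P).card ≤ 1 →
      (unmatchedOf χ false P).card ≤ 1 → L ≤ g P)
    {K : ℕ} (hK : 0 < K) {P : Multiset (Sym2 H)} (hP : IsFull P) :
    L - κ * interpolationError (Finset.univ.filter fun h => χ h = false).card K ≤ g P := by
  set N := (Finset.univ.filter fun h => χ h = false).card with hN
  have hK' : (0 : ℝ) < K := by exact_mod_cast hK
  have hu : (unmatchedOf χ true P).card + (unmatchedOf χ false P).card ≤ 1 := by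
    have h1 := hP.1.card_unmatched
    have h2 := hP.2
    rw [card_unmatchedOf_add]
    lia
  have hu' : ((unmatchedOf χ true P).card : ℝ) + (unmatchedOf χ false P).card ≤ 1 := by
    exact_mod_cast hu
  have hcN : crossCount χ P ≤ N := by
    have h1 := crossCount_le_count (χ := χ) P
    have h2 := hP.1.card_unmatchedOf (χ := χ) false
    lia
  by_cases hc : crossCount χ P < K
  · refine le_trans (sub_le_sub_left (mul_le_mul_of_nonneg_left ?_ hκ) _)
      (sub_le_of_crossCount hκ hlip hL hP.1)
    have h1 : (crossCount χ P : ℝ) ≤ K := by exact_mod_cast hc.le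
    have h2 : (0 : ℝ) ≤ 4 * N / K := by positivity
    have h3 : (0 : ℝ) ≤ 2 * N * (1 + 4 * N) / K ^ 2 := by positivity
    simp only [interpolationError]
    linarith
  · push Not at hc
    obtain ⟨Q, hQP, h1, h2, h3⟩ := exists_remove_cross hP.1 hc
    obtain ⟨R, hR⟩ : ∃ R, R = (unmatchedOf χ true Q).card + (unmatchedOf χ false Q).card :=
      ⟨_, rfl⟩
    have h4 := sub_potential_le hg hκ hlip hconc hL (N := N) (R := R)
      (by rw [hR, h3, h3]; lia) (hP.1.mono hQP) (by lia) hR.symm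
    have h5 := (abs_le.1 (hlip.abs_sub_le hQP)).1
    have h6 : (P.card : ℝ) - Q.card = K := by
      rw [h1]; push_cast; ring
    rw [h6] at h5
    refine le_trans ?_ (by linarith : g Q - κ * K ≤ g P)
    refine le_trans ?_ (sub_le_sub_right h4 _)
    have hRK : 2 * K ≤ R := by rw [hR, h3, h3]; lia
    have hRK2 : R ≤ 2 * K + 1 := by rw [hR, h3, h3]; lia
    have hRK' : (2 : ℝ) * K ≤ R := by exact_mod_cast hRK
    have hRK2' : (R : ℝ) ≤ 2 * K + 1 := by exact_mod_cast hRK2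
    have hD : ((unmatchedOf χ true Q).card - (unmatchedOf χ false Q).card : ℝ) ^ 2 ≤ 1 := by
      rw [h3, h3, sq_le_one_iff_abs_le_one, abs_le]
      have : (0 : ℝ) ≤ (unmatchedOf χ true P).card := by positivity
      have : (0 : ℝ) ≤ (unmatchedOf χ false P).card := by positivity
      push_cast
      constructor <;> linarith
    have hcQ : (crossCount χ Q : ℝ) ≤ N := by exact_mod_cast (by lia)
    have b1 : 8 / R * (crossCount χ Q : ℝ) ≤ 4 * N / K := by
      calc 8 / R * (crossCount χ Q : ℝ) ≤ 8 / (2 * K) * N := by gcongr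
        _ = _ := by field_simp; ring
    have b2 : 8 * N / R ^ 2 *
        (((unmatchedOf χ true Q).card - (unmatchedOf χ false Q).card : ℝ) ^ 2 +
          4 * crossCount χ Q) ≤ 2 * N * (1 + 4 * N) / K ^ 2 := by
      calc _ ≤ 8 * N / (2 * K) ^ 2 * (1 + 4 * (N : ℝ)) := by gcongr
        _ = _ := by field_simp; ring
    have : κ * (R / 2 + 8 / R * (crossCount χ Q : ℝ) + 8 * N / R ^ 2 *
        (((unmatchedOf χ true Q).card - (unmatchedOf χ false Q).card : ℝ) ^ 2 +
          4 * crossCount χ Q)) + κ * K ≤ κ * interpolationError N K := by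
      rw [← mul_add]
      refine mul_le_mul_of_nonneg_left ?_ hκ
      simp only [interpolationError]
      linarith
    linarith

end Colored

end Interpolation

/-! ### Almost superadditivity over disjoint unions -/

section Superadditivity

/-- The weights are pushed forward along `φ`, which need not be injective: half-edges of one vertex
pool their weights, and the total stays zero. -/
theorem IsPairConcave.comp_mapPairs {H V : Type} [Fintype H] [Fintype V]
    {g : Multiset (Sym2 V) → ℝ} (hg : IsPairConcave g) (φ : H → V) :
    IsPairConcave fun P => g (mapPairs φ P) := by
  intro P w hw
  have hfib : ∀ F : V → ℝ, ∑ h, F (φ h) * w h = ∑ v, F v * ∑ h with φ h = v, w h := by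
    intro F
    rw [← Finset.sum_fiberwise Finset.univ φ]
    refine Finset.sum_congr rfl fun v _ => ?_
    rw [Finset.mul_sum]
    exact Finset.sum_congr rfl fun h hh => by rw [(Finset.mem_filter.1 hh).2]
  have h1 := hg (mapPairs φ P) (fun v => ∑ h with φ h = v, w h) (by
    have := hfib fun _ => 1
    simp only [one_mul] at this
    rw [← this, hw])
  refine le_of_eq_of_le ?_ h1
  have h2 : ∀ h, ∑ h', (g (mapPairs φ (s(h, h') ::ₘ P)) - g (mapPairs φ P)) * w h * w h' =
      (∑ v', (g (s(φ h, v') ::ₘ mapPairs φ P) - g (mapPairs φ P)) *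
        ∑ h' with φ h' = v', w h') * w h := by
    intro h
    rw [← hfib fun v' => g (s(φ h, v') ::ₘ mapPairs φ P) - g (mapPairs φ P), Finset.sum_mul]
    refine Finset.sum_congr rfl fun h' _ => ?_
    rw [mapPairs_cons, Sym2.map_mk]
    ring
  rw [Finset.sum_congr rfl fun h _ => h2 h, hfib fun v => ∑ v', (g (s(v, v') ::ₘ mapPairs φ P) -
    g (mapPairs φ P)) * ∑ h' with φ h' = v', w h']
  refine Finset.sum_congr rfl fun v _ => ?_
  rw [Finset.sum_mul]
  exact Finset.sum_congr rfl fun v' _ => by ring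

variable {H₁ H₂ : Type} [Fintype H₁] [Fintype H₂]

/-- The average of `g` over the permutations that preserve both sides of a disjoint union. -/
def sideAvg (g : Multiset (Sym2 (H₁ ⊕ H₂)) → ℝ) (P : Multiset (Sym2 (H₁ ⊕ H₂))) : ℝ :=
  𝔼 p : Equiv.Perm H₁ × Equiv.Perm H₂, g (mapPairs (Equiv.Perm.sumCongr p.1 p.2) P)

variable {g : Multiset (Sym2 (H₁ ⊕ H₂)) → ℝ} {κ : ℝ}

theorem IsPairLipschitz.sideAvg (hg : IsPairLipschitz κ g) : IsPairLipschitz κ (sideAvg g) := by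
  intro e P
  rw [_root_.sideAvg, _root_.sideAvg, ← Finset.expect_sub_distrib]
  exact (Finset.abs_expect_le _ _).trans
    (Finset.expect_le Finset.univ_nonempty fun p _ => hg.comp_mapPairs _ e P)

theorem IsPairConcave.sideAvg (hg : IsPairConcave g) : IsPairConcave (sideAvg g) := by
  intro P w hw
  have : ∀ h h', (_root_.sideAvg g (s(h, h') ::ₘ P) - _root_.sideAvg g P) * w h * w h' =
      𝔼 p : Equiv.Perm H₁ × Equiv.Perm H₂,
        (g (mapPairs (Equiv.Perm.sumCongr p.1 p.2) (s(h, h') ::ₘ P)) -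
          g (mapPairs (Equiv.Perm.sumCongr p.1 p.2) P)) * w h * w h' := by
    intro h h'
    rw [← Finset.expect_mul, ← Finset.expect_mul, Finset.expect_sub_distrib]
    rfl
  simp only [this, ← Finset.expect_sum_comm]
  exact Finset.expect_le Finset.univ_nonempty fun p _ => hg.comp_mapPairs _ P w hw

theorem sideAvg_mapPairs (g : Multiset (Sym2 (H₁ ⊕ H₂)) → ℝ) (σ : Equiv.Perm H₁)
    (τ : Equiv.Perm H₂) (P : Multiset (Sym2 (H₁ ⊕ H₂))) :
    sideAvg g (mapPairs (Equiv.Perm.sumCongr σ τ) P) = sideAvg g P := by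
  refine Fintype.expect_equiv (Equiv.mulRight (σ, τ)) _ _ fun p => ?_
  rw [mapPairs_mapPairs]
  congr 2
  funext x
  cases x <;> rfl

theorem isColorInvariant_sideAvg (g : Multiset (Sym2 (H₁ ⊕ H₂)) → ℝ) :
    IsColorInvariant Sum.isLeft (sideAvg g) := by
  rintro (x | x) (y | y) hxy P
  · rw [← sideAvg_mapPairs g (Equiv.swap x y) 1 P]
    congr 2
    funext z
    rcases z with z | z <;> simp [Equiv.swap_apply_def]
  · simp at hxy
  · simp at hxy
  · rw [← sideAvg_mapPairs g 1 (Equiv.swap x y) P]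
    congr 2
    funext z
    rcases z with z | z <;> simp [Equiv.swap_apply_def]

theorem matchAvg_sideAvg (g : Multiset (Sym2 (H₁ ⊕ H₂)) → ℝ) :
    matchAvg (sideAvg g) = matchAvg g := by
  calc matchAvg (sideAvg g) = 𝔼 p : Equiv.Perm H₁ × Equiv.Perm H₂,
        matchAvg fun P => g (mapPairs (Equiv.Perm.sumCongr p.1 p.2) P) := Finset.expect_comm _ _ _
    _ = _ := by
      simp only [matchAvg_comp_perm]
      exact Fintype.expect_const _

omit [Fintype H₁] [Fintype H₂] in
theorem exists_eq_add_of_crossCount_eq_zero {P : Multiset (Sym2 (H₁ ⊕ H₂))}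
    (h : crossCount Sum.isLeft P = 0) :
    ∃ A B, P = mapPairs Sum.inl A + mapPairs Sum.inr B := by
  induction P using Multiset.induction with
  | empty => exact ⟨0, 0, rfl⟩
  | cons e P ih =>
    induction e with | _ x y =>
    rw [crossCount_cons] at h
    obtain ⟨A, B, rfl⟩ := ih (by lia)
    rcases x with x | x <;> rcases y with y | y <;> simp at h
    · exact ⟨s(x, y) ::ₘ A, B, by simp⟩
    · exact ⟨A, s(x, y) ::ₘ B, by simp⟩

/-- This is the value `L` of the interpolation. One free point may remain on each side, which
accommodates two odd blocks. -/
theorem sideAvg_eq_of_local {g₁ : Multiset (Sym2 H₁) → ℝ} {g₂ : Multiset (Sym2 H₂) → ℝ}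
    (hg : ∀ A B, g (mapPairs Sum.inl A + mapPairs Sum.inr B) = g₁ A + g₂ B)
    {P : Multiset (Sym2 (H₁ ⊕ H₂))} (hP : IsMatching P) (hc : crossCount Sum.isLeft P = 0)
    (h₁ : (unmatchedOf Sum.isLeft true P).card ≤ 1)
    (h₂ : (unmatchedOf Sum.isLeft false P).card ≤ 1) :
    sideAvg g P = matchAvg g₁ + matchAvg g₂ := by
  obtain ⟨A, B, rfl⟩ := exists_eq_add_of_crossCount_eq_zero hc
  have hA : IsMatching A := (hP.mono (Multiset.le_add_right _ _)).of_mapPairs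
  have hB : IsMatching B := (hP.mono (Multiset.le_add_left _ _)).of_mapPairs
  have eA : unmatchedOf Sum.isLeft true (mapPairs Sum.inl A + mapPairs Sum.inr B) =
      (unmatched A).map Function.Embedding.inl := by
    ext (x | x) <;> simp [mem_unmatchedOf, mem_unmatched, ends_mapPairs]
  have eB : unmatchedOf Sum.isLeft false (mapPairs Sum.inl A + mapPairs Sum.inr B) =
      (unmatched B).map Function.Embedding.inr := by
    ext (x | x) <;> simp [mem_unmatchedOf, mem_unmatched, ends_mapPairs]
  rw [eA, Finset.card_map] at h₁
  rw [eB, Finset.card_map] at h₂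
  have hA' : IsFull A := ⟨hA, by have := hA.card_unmatched; lia⟩
  have hB' : IsFull B := ⟨hB, by have := hB.card_unmatched; lia⟩
  rw [matchAvg_eq_expect_perm _ hA', matchAvg_eq_expect_perm _ hB', sideAvg,
    ← Finset.univ_product_univ,
    Finset.expect_product' (f := fun σ τ => g (mapPairs (Equiv.Perm.sumCongr σ τ)
      (mapPairs Sum.inl A + mapPairs Sum.inr B)))]
  have key : ∀ (σ : Equiv.Perm H₁) (τ : Equiv.Perm H₂),
      g (mapPairs (Equiv.Perm.sumCongr σ τ) (mapPairs Sum.inl A + mapPairs Sum.inr B)) =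
        g₁ (mapPairs σ A) + g₂ (mapPairs τ B) := by
    intro σ τ
    rw [← hg, mapPairs_add]
    simp only [mapPairs_mapPairs]
    rfl
  simp only [key, Finset.expect_add_distrib, Fintype.expect_const]

theorem matchAvg_add_le {g₁ : Multiset (Sym2 H₁) → ℝ} {g₂ : Multiset (Sym2 H₂) → ℝ}
    (hκ : 0 ≤ κ) (hlip : IsPairLipschitz κ g) (hconc : IsPairConcave g)
    (hg : ∀ A B, g (mapPairs Sum.inl A + mapPairs Sum.inr B) = g₁ A + g₂ B)
    {K : ℕ} (hK : 0 < K) :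
    matchAvg g₁ + matchAvg g₂ - κ * interpolationError (Fintype.card H₂) K ≤ matchAvg g := by
  rw [← matchAvg_sideAvg g]
  refine Finset.le_expect fullMatchings_nonempty fun m hm => ?_
  have hcard : (Finset.univ.filter fun h : H₁ ⊕ H₂ => h.isLeft = false).card =
      Fintype.card H₂ := by
    have : (Finset.univ.filter fun h : H₁ ⊕ H₂ => h.isLeft = false) =
        Finset.univ.map Function.Embedding.inr := by
      ext (x | x) <;> simp
    rw [this, Finset.card_map, Finset.card_univ]
  have := sub_interpolationError_le (isColorInvariant_sideAvg g) hκ hlip.sideAvg hconc.sideAvg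
    (L := matchAvg g₁ + matchAvg g₂)
    (fun P hP hc h₁ h₂ => (sideAvg_eq_of_local hg hP hc h₁ h₂).ge) hK (mem_fullMatchings.1 hm)
  rwa [hcard] at this

end Superadditivity

/-! ### Means of a graph parameter under the configuration model -/

namespace GraphParameter

variable (f : GraphParameter) {κ : ℝ}

theorem IsLipschitz.nonneg {f : GraphParameter} (hf : f.IsLipschitz κ) : 0 ≤ κ :=
  (abs_nonneg _).trans (hf (⟨0⟩ : Multigraph Unit) () ())

theorem IsLipschitz.isPairLipschitz {f : GraphParameter} (hf : f.IsLipschitz κ) {V : Type}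
    [Finite V] : IsPairLipschitz κ fun P : Multiset (Sym2 V) => f.val ⟨P⟩ := by
  intro e P
  induction e with | _ i j =>
  exact hf ⟨P⟩ i j

theorem IsConcave.isPairConcave {f : GraphParameter} (hf : f.IsConcave) {V : Type} [Fintype V] :
    IsPairConcave fun P : Multiset (Sym2 V) => f.val ⟨P⟩ :=
  fun P w hw => hf ⟨P⟩ w hw

theorem val_mapPairs {V W : Type} [Finite V] [Finite W] (e : V ≃ W) (P : Multiset (Sym2 V)) :
    f.val ⟨mapPairs e P⟩ = f.val ⟨P⟩ :=
  f.val_iso e ⟨P⟩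

/-- The mean of `f` under the configuration model. -/
def meanVal {V : Type} [Fintype V] (d : V → ℕ) : ℝ :=
  matchAvg fun P : Multiset (Sym2 (HalfEdge d)) => f.val ⟨mapPairs Sigma.fst P⟩

theorem card_halfEdge {V : Type} [Fintype V] (d : V → ℕ) :
    Fintype.card (HalfEdge d) = ∑ i, d i := by
  simp

variable {f}

theorem IsLipschitz.abs_meanVal_sub_le_of_le (hf : f.IsLipschitz κ) {V W : Type} [Fintype V]
    [Fintype W] {d : V → ℕ} {d' : W → ℕ} (e : V ≃ W) (h : ∀ i, d i ≤ d' (e i)) :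
    |f.meanVal d' - f.meanVal d| ≤ 2 * κ * (∑ i, (d' (e i) : ℝ) - ∑ i, (d i : ℝ)) := by
  let ι : HalfEdge d → HalfEdge d' := fun x => ⟨e x.1, Fin.castLE (h x.1) x.2⟩
  have hι : Function.Injective ι := by
    rintro ⟨i, x⟩ ⟨j, y⟩ hxy
    obtain rfl : i = j := e.injective (congrArg Sigma.fst hxy)
    have : Fin.castLE (h i) x = Fin.castLE (h i) y := by
      simpa [ι] using hxy
    rw [Fin.castLE_injective _ this]
  have := abs_matchAvg_sub_le hf.nonneg hι (hf.isPairLipschitz.comp_mapPairs (Sigma.fst (β := fun i => Fin (d' i))))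
  rw [card_halfEdge, card_halfEdge, ← Equiv.sum_comp e d'] at this
  push_cast at this
  have e1 : ∀ P : Multiset (Sym2 (HalfEdge d)),
      f.val ⟨mapPairs Sigma.fst (mapPairs ι P)⟩ = f.val ⟨mapPairs Sigma.fst P⟩ := by
    intro P
    rw [← f.val_mapPairs e (mapPairs Sigma.fst P), mapPairs_mapPairs, mapPairs_mapPairs]
    rfl
  simp only [e1] at this
  exact this

theorem IsLipschitz.meanVal_eq (hf : f.IsLipschitz κ) {V W : Type} [Fintype V]
    [Fintype W] {d : V → ℕ} {d' : W → ℕ} (e : V ≃ W) (h : ∀ i, d i = d' (e i)) :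
    f.meanVal d' = f.meanVal d := by
  have := hf.abs_meanVal_sub_le_of_le e fun i => (h i).le
  simp only [h, sub_self, mul_zero] at this
  exact sub_eq_zero.1 (abs_nonpos_iff.1 this)

theorem meanVal_add_le (hadd : f.IsAdditive) (hf : f.IsLipschitz κ) (hconc : f.IsConcave)
    {V W : Type} [Fintype V] [Fintype W] (d : V → ℕ) (d' : W → ℕ) {K : ℕ} (hK : 0 < K) :
    f.meanVal d + f.meanVal d' - κ * interpolationError (∑ i, d' i) K ≤
      f.meanVal (Sum.elim d d') := by
  let e : HalfEdge d ⊕ HalfEdge d' ≃ HalfEdge (Sum.elim d d') :=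
    (Equiv.sumSigmaDistrib fun i => Fin (Sum.elim d d' i)).symm
  let φ : HalfEdge d ⊕ HalfEdge d' → V ⊕ W := fun x => (e x).1
  have hcard : Fintype.card (HalfEdge d ⊕ HalfEdge d') =
      Fintype.card (HalfEdge (Sum.elim d d')) := Fintype.card_congr e
  -- For a bijection the stability bound is zero, so this is invariance under relabelling the
  -- half-edges.
  have h1 := abs_matchAvg_sub_le hf.nonneg e.injective (hf.isPairLipschitz.comp_mapPairs
    (Sigma.fst (β := fun i => Fin (Sum.elim d d' i))))
  rw [hcard, sub_self, mul_zero] at h1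
  have h2 : f.meanVal (Sum.elim d d') = matchAvg fun P => f.val ⟨mapPairs φ P⟩ := by
    have := sub_eq_zero.1 (abs_nonpos_iff.1 h1)
    simp only [mapPairs_mapPairs] at this
    exact this
  rw [h2, ← card_halfEdge d']
  refine matchAvg_add_le hf.nonneg (hf.isPairLipschitz.comp_mapPairs φ)
    (hconc.isPairConcave.comp_mapPairs φ) (fun A B => ?_) hK
  have := hadd (⟨mapPairs Sigma.fst A⟩ : Multigraph V) (⟨mapPairs Sigma.fst B⟩ : Multigraph W)
  rw [← this, mapPairs_add, mapPairs_mapPairs, mapPairs_mapPairs]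
  congr 2
  change _ = mapPairs Sum.inl _ + mapPairs Sum.inr _
  rw [mapPairs_mapPairs, mapPairs_mapPairs]
  rfl

theorem meanVal_append (hf : f.IsLipschitz κ) {m n : ℕ} (d : Fin m → ℕ) (d' : Fin n → ℕ) :
    f.meanVal (Fin.append d d') = f.meanVal (Sum.elim d d') :=
  hf.meanVal_eq finSumFinEquiv fun i => by cases i <;> simp

theorem val_empty_eq (hadd : f.IsAdditive) (n : ℕ) :
    f.val (⟨0⟩ : Multigraph (Fin n)) = n * f.val (⟨0⟩ : Multigraph (Fin 1)) := by
  have hsum : ∀ m n : ℕ, f.val (⟨0⟩ : Multigraph (Fin (m + n))) =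
      f.val (⟨0⟩ : Multigraph (Fin m)) + f.val (⟨0⟩ : Multigraph (Fin n)) := fun m n => by
    rw [← hadd, ← f.val_iso finSumFinEquiv]
    rfl
  induction n with
  | zero =>
    have := hsum 0 0
    rw [add_zero] at this
    rw [Nat.cast_zero, zero_mul]
    linarith
  | succ n ih => rw [hsum, ih]; push_cast; ring

theorem meanVal_zero (hadd : f.IsAdditive) (n : ℕ) :
    f.meanVal (0 : Fin n → ℕ) = n * f.val (⟨0⟩ : Multigraph (Fin 1)) := by
  rw [← val_empty_eq hadd, meanVal, matchAvg,
    ← Finset.expect_const (fullMatchings_nonempty (H := HalfEdge (0 : Fin n → ℕ)))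
      (f.val (⟨0⟩ : Multigraph (Fin n)))]
  refine Finset.expect_congr rfl fun m hm => ?_
  have h := (mem_fullMatchings.1 hm).1.two_mul_card_le
  rw [card_halfEdge] at h
  have : m.val = 0 := Multiset.card_eq_zero.1 (by simpa using h)
  rw [this, mapPairs_zero]

end GraphParameter

/-! ### Convergence in ℓ¹ -/

section SummableSequences

theorem memℓp_one_of_summable {a : ℕ → ℝ} (h : Summable fun k => |a k|) :
    Memℓp a 1 := memℓp_gen (by simpa using h)

theorem lp_one_norm_eq (x : lp (fun _ : ℕ => ℝ) 1) : ‖x‖ = ∑' k, |x k| := by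
  rw [lp.norm_eq_tsum_rpow (by simp)]
  simp

theorem lp_one_summable (x : lp (fun _ : ℕ => ℝ) 1) : Summable fun k => |x k| := by
  have := (lp.memℓp x).summable (by simp)
  simpa using this

theorem abs_eq_add_two_mul_max (x : ℝ) : |x| = x + 2 * max (-x) 0 := by
  rcases le_total 0 x with h | h
  · rw [abs_of_nonneg h, max_eq_right (by linarith)]; ring
  · rw [abs_of_nonpos h, max_eq_left (by linarith)]; ring

/-- Scheffé's lemma for summable sequences. -/
theorem lp_one_tendsto_of_tendsto_apply {a : ℕ → lp (fun _ : ℕ => ℝ) 1}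
    {b : lp (fun _ : ℕ => ℝ) 1} (ha : ∀ n k, 0 ≤ a n k) (hb : ∀ k, 0 ≤ b k)
    (h : ∀ k, Tendsto (fun n => a n k) atTop (𝓝 (b k)))
    (hnorm : Tendsto (fun n => ‖a n‖) atTop (𝓝 ‖b‖)) : Tendsto a atTop (𝓝 b) := by
  rw [tendsto_iff_norm_sub_tendsto_zero]
  have hbs := lp_one_summable b
  have hsb : Summable fun k => b k := hbs.of_abs
  have hsa : ∀ n, Summable fun k => a n k := fun n => (lp_one_summable (a n)).of_abs
  have hle : ∀ n k, |max (-(a n k - b k)) 0| ≤ |b k| := fun n k => by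
    rw [abs_of_nonneg (le_max_right _ _), abs_of_nonneg (hb k)]
    exact max_le (by linarith [ha n k]) (hb k)
  have hmax : ∀ n, Summable fun k => max (-(a n k - b k)) 0 := fun n =>
    (hbs.of_nonneg_of_le (fun _ => abs_nonneg _) (hle n)).of_abs
  -- The negative part of a - b is dominated by b, so only that part needs dominated convergence;
  -- the norms account for the rest.
  have key : ∀ n, ‖a n - b‖ = ‖a n‖ - ‖b‖ + 2 * ∑' k, max (-(a n k - b k)) 0 := by
    intro n
    rw [lp_one_norm_eq, lp_one_norm_eq, lp_one_norm_eq, ← tsum_mul_left,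
      ← (lp_one_summable (a n)).tsum_sub hbs,
      ← ((lp_one_summable (a n)).sub hbs).tsum_add ((hmax n).mul_left 2)]
    refine tsum_congr fun k => ?_
    rw [abs_of_nonneg (ha n k), abs_of_nonneg (hb k)]
    exact abs_eq_add_two_mul_max _
  have hdom : Tendsto (fun n => ∑' k, max (-(a n k - b k)) 0) atTop (𝓝 (∑' _ : ℕ, (0 : ℝ))) := by
    refine tendsto_tsum_of_dominated_convergence hbs (fun k => ?_)
      (Eventually.of_forall fun n k => hle n k)
    have := (((h k).sub_const (b k)).neg).max (tendsto_const_nhds (x := (0 : ℝ)))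
    simpa using this
  have := (hnorm.sub_const ‖b‖).add (hdom.const_mul 2)
  simp only [sub_self, tsum_zero, mul_zero, add_zero] at this
  exact this.congr fun n => (key n).symm

end SummableSequences

/-! ### Degree sequences encoded by their tail counts -/

section Tails

variable {n : ℕ}

/-- The number of vertices whose degree exceeds `k`. -/
def tailCount (d : Fin n → ℕ) (k : ℕ) : ℕ := (Finset.univ.filter fun i => k < d i).card

theorem tailCount_eq_sum (d : Fin n → ℕ) (k : ℕ) :
    (tailCount d k : ℝ) = ∑ i, if k < d i then (1 : ℝ) else 0 := by
  simp [tailCount]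

theorem hasSum_ite_lt (m : ℕ) : HasSum (fun k : ℕ => if k < m then (1 : ℝ) else 0) m := by
  have h : HasSum (fun k : ℕ => if k < m then (1 : ℝ) else 0)
      (∑ k ∈ Finset.range m, if k < m then (1 : ℝ) else 0) :=
    hasSum_sum_of_ne_finset_zero fun k hk => by simpa using hk
  rwa [Finset.sum_congr rfl fun k hk => if_pos (Finset.mem_range.1 hk), Finset.sum_const,
    Finset.card_range, nsmul_one] at h

theorem hasSum_tailCount (d : Fin n → ℕ) :
    HasSum (fun k => (tailCount d k : ℝ)) (∑ i, (d i : ℝ)) := by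
  simp only [tailCount_eq_sum]
  exact hasSum_sum fun i _ => hasSum_ite_lt (d i)

/-- The tail counts of a degree sequence, as a summable sequence. -/
def tailVec (d : Fin n → ℕ) : lp (fun _ : ℕ => ℝ) 1 :=
  ⟨fun k => (tailCount d k : ℝ), memℓp_one_of_summable (by
    simpa using (hasSum_tailCount d).summable)⟩

theorem tailVec_apply (d : Fin n → ℕ) (k : ℕ) : tailVec d k = tailCount d k := rfl

theorem norm_tailVec (d : Fin n → ℕ) : ‖tailVec d‖ = ∑ i, (d i : ℝ) := by
  rw [lp_one_norm_eq, ← (hasSum_tailCount d).tsum_eq]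
  simp [tailVec_apply]

theorem tailVec_zero : tailVec (0 : Fin n → ℕ) = 0 := by
  rw [← norm_eq_zero, norm_tailVec]; simp

theorem tailVec_append {m : ℕ} (d : Fin m → ℕ) (d' : Fin n → ℕ) :
    tailVec (Fin.append d d') = tailVec d + tailVec d' := by
  refine lp.ext (funext fun k => ?_)
  rw [lp.coeFn_add, Pi.add_apply, tailVec_apply, tailVec_apply, tailVec_apply]
  simp only [tailCount_eq_sum, Fin.sum_univ_add, Fin.append_left, Fin.append_right]

theorem tailVec_comp_perm (d : Fin n → ℕ) (σ : Equiv.Perm (Fin n)) :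
    tailVec (d ∘ σ) = tailVec d := by
  refine lp.ext (funext fun k => ?_)
  rw [tailVec_apply, tailVec_apply, tailCount_eq_sum, tailCount_eq_sum]
  exact Equiv.sum_comp σ fun i => if k < d i then (1 : ℝ) else 0

theorem hasSum_abs_ite_sub_ite (a b : ℕ) : HasSum (fun k : ℕ =>
    |(if k < a then (1 : ℝ) else 0) - if k < b then (1 : ℝ) else 0|) |(a : ℝ) - b| := by
  wlog h : b ≤ a generalizing a b
  · simpa only [abs_sub_comm] using this b a (le_of_not_ge h)
  rw [abs_of_nonneg (sub_nonneg.2 (Nat.cast_le.2 h))]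
  have e : ∀ k : ℕ, |(if k < a then (1 : ℝ) else 0) - if k < b then (1 : ℝ) else 0| =
      (if k < a then (1 : ℝ) else 0) - if k < b then (1 : ℝ) else 0 := fun k => abs_of_nonneg (by
    split_ifs <;> first | (exfalso; lia) | norm_num)
  simp only [e]
  exact (hasSum_ite_lt a).sub (hasSum_ite_lt b)

/-- For sorted sequences the vertices of degree above k form two final segments. These are nested,
so no cancellation occurs at any level k. -/
theorem sum_abs_sub_eq_norm {d d' : Fin n → ℕ} (hd : Monotone d) (hd' : Monotone d') :
    ∑ i, |(d i : ℝ) - d' i| = ‖tailVec d - tailVec d'‖ := by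
  rw [lp_one_norm_eq]
  have hs : HasSum (fun k => ∑ i, |(if k < d i then (1 : ℝ) else 0) - if k < d' i then 1 else 0|)
      (∑ i, |(d i : ℝ) - d' i|) := hasSum_sum fun i _ => hasSum_abs_ite_sub_ite (d i) (d' i)
  rw [← hs.tsum_eq]
  refine tsum_congr fun k => ?_
  rw [lp.coeFn_sub, Pi.sub_apply, tailVec_apply, tailVec_apply, tailCount_eq_sum,
    tailCount_eq_sum, ← Finset.sum_sub_distrib]
  by_cases h : ∀ i, k < d i → k < d' i
  · rw [← abs_neg, ← Finset.sum_neg_distrib, Finset.abs_sum_of_nonneg]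
    · refine Finset.sum_congr rfl fun i _ => ?_
      rw [abs_of_nonpos]
      have := h i
      split_ifs <;> first | (exfalso; lia) | norm_num
    · intro i _
      have := h i
      split_ifs <;> first | (exfalso; lia) | norm_num
  · push Not at h
    obtain ⟨i, hi, hi'⟩ := h
    have h : ∀ j, k < d' j → k < d j := by
      intro j hj
      rcases le_total i j with hij | hij
      · exact hi.trans_le (hd hij)
      · exact absurd (hj.trans_le (hd' hij)) (not_lt.2 hi')
    rw [Finset.abs_sum_of_nonneg]
    · refine Finset.sum_congr rfl fun j _ => ?_
      rw [abs_of_nonneg]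
      have := h j
      split_ifs <;> first | (exfalso; lia) | norm_num
    · intro j _
      have := h j
      split_ifs <;> first | (exfalso; lia) | norm_num

end Tails

/-! ### Wasserstein stability and concatenation of blocks -/

namespace GraphParameter

variable {f : GraphParameter} {κ : ℝ}

/-- Both sequences dominate their pointwise minimum, and the two excesses add up to the sum of
absolute differences. -/
theorem IsLipschitz.abs_meanVal_sub_le_sum (hf : f.IsLipschitz κ) {V : Type} [Fintype V]
    (d d' : V → ℕ) : |f.meanVal d - f.meanVal d'| ≤ 2 * κ * ∑ i, |(d i : ℝ) - d' i| := by
  have h1 := hf.abs_meanVal_sub_le_of_le (d := d ⊓ d') (d' := d) (Equiv.refl V)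
    fun i => by simp
  have h2 := hf.abs_meanVal_sub_le_of_le (d := d ⊓ d') (d' := d') (Equiv.refl V)
    fun i => by simp
  rw [abs_sub_comm] at h2
  refine (_root_.abs_sub_le _ (f.meanVal (d ⊓ d')) _).trans ((add_le_add h1 h2).trans (le_of_eq ?_))
  rw [← mul_add, ← Finset.sum_sub_distrib, ← Finset.sum_sub_distrib, ← Finset.sum_add_distrib]
  congr 1
  refine Finset.sum_congr rfl fun i _ => ?_
  simp only [Equiv.refl_apply, Pi.inf_apply, Nat.cast_min]
  rcases le_total (d i : ℝ) (d' i) with h | h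
  · rw [min_eq_left h, abs_of_nonpos (by linarith)]; ring
  · rw [min_eq_right h, abs_of_nonneg (by linarith)]; ring

theorem IsLipschitz.abs_meanVal_sub_le (hf : f.IsLipschitz κ) {n : ℕ} (d d' : Fin n → ℕ) :
    |f.meanVal d - f.meanVal d'| ≤ 2 * κ * ‖tailVec d - tailVec d'‖ := by
  rw [← tailVec_comp_perm d (Tuple.sort d), ← tailVec_comp_perm d' (Tuple.sort d'),
    ← sum_abs_sub_eq_norm (Tuple.monotone_sort d) (Tuple.monotone_sort d'),
    hf.meanVal_eq (d := d ∘ Tuple.sort d) (d' := d) (Tuple.sort d) fun _ => rfl,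
    hf.meanVal_eq (d := d' ∘ Tuple.sort d') (d' := d') (Tuple.sort d') fun _ => rfl]
  exact hf.abs_meanVal_sub_le_sum _ _

end GraphParameter

theorem exists_interpolationError_le {ε : ℝ} (hε : 0 < ε) :
    ∃ C, 0 ≤ C ∧ ∀ N : ℕ, ∃ K : ℕ, 0 < K ∧ interpolationError N K ≤ ε * N + C := by
  refine ⟨5 + 8 / ε + (4 / ε) * (1 + 8 / ε), by positivity, fun N => ?_⟩
  -- With `K` of order εN/2, the term 2K gives εN, and the ratio N/K stays below 2/ε. The added 1
  -- keeps `K` positive when N is small.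
  refine ⟨⌊ε / 2 * N⌋₊ + 1, Nat.succ_pos _, ?_⟩
  set K := ⌊ε / 2 * N⌋₊ + 1 with hKdef
  have hK1 : (1 : ℝ) ≤ K := by rw [hKdef]; push_cast; linarith [Nat.cast_nonneg (α := ℝ) ⌊ε / 2 * N⌋₊]
  have hK2 : (K : ℝ) ≤ ε / 2 * N + 1 := by
    rw [hKdef]; push_cast
    linarith [Nat.floor_le (by positivity : 0 ≤ ε / 2 * (N : ℝ))]
  have hK3 : ε / 2 * N ≤ K := by
    rw [hKdef]; push_cast
    exact (Nat.lt_floor_add_one _).le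
  have hK : (0 : ℝ) < K := by linarith
  have hN : (N : ℝ) / K ≤ 2 / ε := by
    rw [div_le_div_iff₀ hK hε]; linarith
  have hN0 : 0 ≤ (N : ℝ) / K := by positivity
  have h1 : 1 / (K : ℝ) ≤ 1 := by rw [div_le_one₀ hK]; exact hK1
  have e1 : 2 * (N : ℝ) * (1 + 4 * N) / K ^ 2 = 2 * (N / K) * (1 / K + 4 * (N / K)) := by
    field_simp
  have e2 : 4 * (N : ℝ) / K = 4 * (N / K) := by ring
  have e3 : 2 * ((N : ℝ) / K) * (1 / K + 4 * (N / K)) ≤ 2 * (2 / ε) * (1 + 4 * (2 / ε)) := by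
    gcongr
  have e4 : 2 * (2 / ε) * (1 + 4 * (2 / ε)) = (4 / ε) * (1 + 8 / ε) := by ring
  have e5 : 4 * (2 / ε) = 8 / ε := by ring
  rw [interpolationError, e1, e2]
  linarith

namespace GraphParameter

variable {f : GraphParameter} {κ : ℝ}

theorem exists_concat (hadd : f.IsAdditive) (hf : f.IsLipschitz κ) (hconc : f.IsConcave)
    {ε : ℝ} (hε : 0 < ε) : ∃ C, 0 ≤ C ∧ ∀ (m n N : ℕ), N = m + n →
      ∀ (d : Fin m → ℕ) (d' : Fin n → ℕ), ∃ e : Fin N → ℕ, tailVec e = tailVec d + tailVec d' ∧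
        f.meanVal d + f.meanVal d' - κ * (ε * ‖tailVec d'‖ + C) ≤ f.meanVal e := by
  obtain ⟨C, hC, h⟩ := exists_interpolationError_le hε
  refine ⟨C, hC, ?_⟩
  rintro m n N rfl d d'
  refine ⟨Fin.append d d', tailVec_append d d', ?_⟩
  obtain ⟨K, hK, hE⟩ := h (∑ i, d' i)
  rw [meanVal_append hf]
  refine le_trans ?_ (meanVal_add_le hadd hf hconc d d' hK)
  rw [norm_tailVec]
  push_cast at hE
  linarith [mul_le_mul_of_nonneg_left hE hf.nonneg]

/-- Copies are attached one at a time. The error of each step involves only the newly attached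
block, so the total error is linear in `q`; the `r` remaining vertices are isolated. -/
theorem exists_copies (hadd : f.IsAdditive) (hf : f.IsLipschitz κ) (hconc : f.IsConcave)
    {ε : ℝ} (hε : 0 < ε) : ∃ C, 0 ≤ C ∧ ∀ (n q r N : ℕ), N = q * n + r →
      ∀ d : Fin n → ℕ, ∃ e : Fin N → ℕ, tailVec e = (q : ℝ) • tailVec d ∧
        q * (f.meanVal d - κ * (ε * ‖tailVec d‖ + C)) + r * f.val (⟨0⟩ : Multigraph (Fin 1)) -
          κ * C ≤ f.meanVal e := by
  obtain ⟨C, hC, h⟩ := exists_concat hadd hf hconc hε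
  refine ⟨C, hC, fun n q r N hN d => ?_⟩
  have hcopies : ∀ q : ℕ, ∃ e : Fin (q * n) → ℕ, tailVec e = (q : ℝ) • tailVec d ∧
      q * (f.meanVal d - κ * (ε * ‖tailVec d‖ + C)) ≤ f.meanVal e := by
    intro q
    induction q with
    | zero => exact ⟨0, by simp [tailVec_zero], by rw [meanVal_zero hadd]; simp⟩
    | succ q ih =>
      obtain ⟨e, he, hfe⟩ := ih
      obtain ⟨e', he', hfe'⟩ := h _ _ ((q + 1) * n) (by ring) e d
      refine ⟨e', ?_, ?_⟩
      · rw [he', he, Nat.cast_succ, add_smul, one_smul]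
      · push_cast; linarith
  obtain ⟨e, he, hfe⟩ := hcopies q
  obtain ⟨e', he', hfe'⟩ := h _ _ N hN e (0 : Fin r → ℕ)
  refine ⟨e', ?_, ?_⟩
  · rw [he', he, tailVec_zero, add_zero]
  · rw [meanVal_zero hadd, tailVec_zero, norm_zero, mul_zero, zero_add] at hfe'
    linarith

end GraphParameter

/-! ### Tails of measures, and convergence of degree sequences -/

namespace P1

theorem mean_nonneg (μ : P1) : 0 ≤ μ.mean := integral_nonneg fun k => Nat.cast_nonneg k

/-- The layer-cake formula for the mean. -/
theorem tsum_measure_Ioi (μ : P1) :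
    ∑' k : ℕ, (μ.1 : Measure ℕ) (Set.Ioi k) = ENNReal.ofReal μ.mean := by
  have h1 : ∀ n : ℕ, ∑' k : ℕ, (Set.Ioi k).indicator (fun _ => (1 : ENNReal)) n = n := by
    intro n
    rw [tsum_eq_sum (s := Finset.range n) fun k hk => by
      simpa [Set.indicator_apply] using hk]
    rw [Finset.sum_congr rfl fun k hk => Set.indicator_of_mem
      (Set.mem_Ioi.2 (Finset.mem_range.1 hk)) _]
    simp
  rw [mean, ofReal_integral_eq_lintegral_ofReal μ.2 (ae_of_all _ fun k => Nat.cast_nonneg k)]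
  simp only [ENNReal.ofReal_natCast]
  rw [← lintegral_congr h1, lintegral_tsum fun k => (measurable_of_countable _).aemeasurable]
  refine tsum_congr fun k => ?_
  rw [lintegral_indicator_const (Set.to_countable _).measurableSet, one_mul]

theorem hasSum_real_Ioi (μ : P1) :
    HasSum (fun k : ℕ => (μ.1 : Measure ℕ).real (Set.Ioi k)) μ.mean := by
  have h : ∑' k : ℕ, (μ.1 : Measure ℕ) (Set.Ioi k) ≠ ⊤ := by
    rw [tsum_measure_Ioi]; exact ENNReal.ofReal_ne_top
  have h1 := (ENNReal.summable_toReal h).hasSum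
  rw [← ENNReal.tsum_toReal_eq fun k => measure_ne_top _ _, tsum_measure_Ioi,
    ENNReal.toReal_ofReal μ.mean_nonneg] at h1
  exact h1

theorem hasSum_mass (μ : P1) (i : ℕ) :
    HasSum (fun k : ℕ => μ.mass (i + 1 + k)) ((μ.1 : Measure ℕ).real (Set.Ioi i)) := by
  have hU : Set.Ioi i = ⋃ k : ℕ, {i + 1 + k} := by
    ext m
    simp only [Set.mem_Ioi, Set.mem_iUnion, Set.mem_singleton_iff]
    exact ⟨fun h => ⟨m - (i + 1), by lia⟩, fun ⟨k, hk⟩ => by lia⟩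
  have h : (μ.1 : Measure ℕ) (Set.Ioi i) = ∑' k : ℕ, (μ.1 : Measure ℕ) {i + 1 + k} := by
    rw [hU, measure_iUnion (fun a b hab => by simpa [Function.onFun] using hab)
      fun k => MeasurableSet.singleton _]
  have h1 := (ENNReal.summable_toReal (h ▸ measure_ne_top (μ.1 : Measure ℕ) (Set.Ioi i))).hasSum
  rw [← ENNReal.tsum_toReal_eq fun k => measure_ne_top _ _, ← h] at h1
  exact h1

/-- The tail probabilities of `μ`, as a summable sequence. -/
def tailVec (μ : P1) : lp (fun _ : ℕ => ℝ) 1 :=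
  ⟨fun k => (μ.1 : Measure ℕ).real (Set.Ioi k), memℓp_one_of_summable μ.hasSum_real_Ioi.summable.abs⟩

theorem tailVec_apply (μ : P1) (k : ℕ) : μ.tailVec k = (μ.1 : Measure ℕ).real (Set.Ioi k) := rfl

theorem norm_tailVec (μ : P1) : ‖μ.tailVec‖ = μ.mean := by
  rw [lp_one_norm_eq, ← μ.hasSum_real_Ioi.tsum_eq]
  exact tsum_congr fun k => abs_of_nonneg measureReal_nonneg

theorem wasserstein_eq (μ μ' : P1) : wasserstein μ μ' = ‖μ.tailVec - μ'.tailVec‖ := by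
  rw [lp_one_norm_eq, wasserstein]
  refine tsum_congr fun i => ?_
  rw [((μ.hasSum_mass i).sub (μ'.hasSum_mass i)).tsum_eq]
  rfl

theorem tailVec_mix (θ : ℝ) (hθ : θ ∈ Set.Icc (0 : ℝ) 1) (μ μ' : P1) :
    (mix θ hθ μ μ').tailVec = θ • μ.tailVec + (1 - θ) • μ'.tailVec := by
  refine lp.ext (funext fun k => ?_)
  have h1 : (ENNReal.ofReal θ • (μ.1 : Measure ℕ)) (Set.Ioi k) ≠ ⊤ :=
    ENNReal.mul_ne_top ENNReal.ofReal_ne_top (measure_ne_top _ _)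
  have h2 : (ENNReal.ofReal (1 - θ) • (μ'.1 : Measure ℕ)) (Set.Ioi k) ≠ ⊤ :=
    ENNReal.mul_ne_top ENNReal.ofReal_ne_top (measure_ne_top _ _)
  rw [lp.coeFn_add, Pi.add_apply, lp.coeFn_smul, lp.coeFn_smul, Pi.smul_apply, Pi.smul_apply,
    tailVec_apply, tailVec_apply, tailVec_apply, mix, ProbabilityMeasure.coe_mk,
    measureReal_add_apply h1 h2, measureReal_ennreal_smul_apply, measureReal_ennreal_smul_apply,
    ENNReal.toReal_ofReal hθ.1, ENNReal.toReal_ofReal (sub_nonneg.2 hθ.2)]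
  rfl

end P1

/-- The normalized tail counts of the degree sequences `d n` tend to the tail probabilities
of `μ`. -/
def TailsTendsto (d : ∀ n : ℕ, Fin n → ℕ) (μ : P1) : Prop :=
  Tendsto (fun n : ℕ => (n : ℝ)⁻¹ • tailVec (d n)) atTop (𝓝 μ.tailVec)

theorem norm_inv_smul_tailVec (n : ℕ) (d : Fin n → ℕ) :
    ‖(n : ℝ)⁻¹ • tailVec d‖ = (∑ i, (d i : ℝ)) / n := by
  rw [norm_smul, norm_tailVec, Real.norm_of_nonneg (by positivity)]
  ring

theorem tailCount_add_sum {n : ℕ} (d : Fin n → ℕ) (k : ℕ) :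
    (tailCount d k : ℝ) + ∑ j ∈ Finset.Iic k, ∑ i, (if d i = j then (1 : ℝ) else 0) = n := by
  rw [tailCount_eq_sum, Finset.sum_comm, ← Finset.sum_add_distrib]
  have : ∀ i, ((if k < d i then (1 : ℝ) else 0) +
      ∑ j ∈ Finset.Iic k, if d i = j then (1 : ℝ) else 0) = 1 := by
    intro i
    rw [Finset.sum_ite_eq]
    simp only [Finset.mem_Iic]
    split_ifs <;> first | (exfalso; lia) | norm_num
  simp only [this]
  simp

/-- Degree proportions give the tails coordinatewise, and the average degree is the ℓ¹ norm;
Scheffé's lemma combines the two. -/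
theorem Approaches.tailsTendsto {d : ∀ n : ℕ, Fin n → ℕ} {μ : P1} (h : Approaches d μ) :
    TailsTendsto d μ := by
  refine lp_one_tendsto_of_tendsto_apply (fun n k => ?_) (fun k => measureReal_nonneg)
    (fun k => ?_) ?_
  · rw [lp.coeFn_smul, Pi.smul_apply, tailVec_apply, smul_eq_mul]
    positivity
  · have h1 : Tendsto (fun n : ℕ => 1 - ∑ j ∈ Finset.Iic k,
        (∑ i, if d n i = j then (1 : ℝ) else 0) / n) atTop
        (𝓝 (1 - ∑ j ∈ Finset.Iic k, μ.mass j)) :=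
      (tendsto_finsetSum _ fun j _ => h.1 j).const_sub 1
    have h2 : 1 - ∑ j ∈ Finset.Iic k, μ.mass j = μ.tailVec k := by
      have h3 : ∑ j ∈ Finset.Iic k, μ.mass j = (μ.1 : Measure ℕ).real (Set.Iic k) := by
        have := sum_measureReal_singleton (μ := (μ.1 : Measure ℕ)) (Finset.Iic k)
        rwa [Finset.coe_Iic] at this
      rw [h3, P1.tailVec_apply, ← Set.compl_Iic, measureReal_compl measurableSet_Iic,
        probReal_univ]
    rw [h2] at h1
    refine h1.congr' ?_
    filter_upwards [eventually_gt_atTop 0] with n hn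
    have hn' : (n : ℝ) ≠ 0 := by positivity
    rw [lp.coeFn_smul, Pi.smul_apply, tailVec_apply, smul_eq_mul, ← Finset.sum_div,
      ← tailCount_add_sum (d n) k]
    rw [← tailCount_add_sum (d n) k] at hn'
    field_simp
    ring
  · simp only [norm_inv_smul_tailVec, P1.norm_tailVec]
    exact h.2

theorem exists_tailsTendsto (μ : P1) : ∃ d : ∀ n : ℕ, Fin n → ℕ, TailsTendsto d μ := by
  have hanti : ∀ {j k : ℕ}, j ≤ k → μ.tailVec k ≤ μ.tailVec j := fun h =>
    measureReal_mono (Set.Ioi_subset_Ioi h)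
  have hle1 : ∀ k, μ.tailVec k ≤ 1 := fun k => measureReal_le_one
  have hnn : ∀ k, 0 ≤ μ.tailVec k := fun k => measureReal_nonneg
  have hlim : Tendsto (fun k => μ.tailVec k) atTop (𝓝 0) :=
    (lp_one_summable μ.tailVec).of_abs.tendsto_atTop_zero
  have hex : ∀ n i : ℕ, ∃ k, n * μ.tailVec k < i + 1 := by
    intro n i
    have := hlim.const_mul (n : ℝ)
    rw [mul_zero] at this
    exact (this.eventually (gt_mem_nhds (by positivity : (0 : ℝ) < i + 1))).exists
  -- The quantile construction: exactly ⌊n·μ(k, ∞)⌋ vertices have degree above k, and the error is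
  -- dominated by the summable tail.
  refine ⟨fun n i => Nat.find (hex n i), ?_⟩
  have hcount : ∀ n k : ℕ,
      tailCount (fun i : Fin n => Nat.find (hex n i)) k = ⌊n * μ.tailVec k⌋₊ := by
    intro n k
    have h1 : ∀ i : Fin n, k < Nat.find (hex n i) ↔ i.1 < ⌊n * μ.tailVec k⌋₊ := by
      intro i
      rw [Nat.lt_find_iff, ← Nat.succ_le_iff, Nat.le_floor_iff (by have := hnn k; positivity)]
      push_cast
      refine ⟨fun h => not_lt.1 (h k le_rfl), fun h m hm => not_lt.2 (h.trans ?_)⟩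
      exact mul_le_mul_of_nonneg_left (hanti hm) (Nat.cast_nonneg n)
    have h2 : ⌊n * μ.tailVec k⌋₊ ≤ n := by
      refine Nat.floor_le_of_le ?_
      exact mul_le_of_le_one_right (Nat.cast_nonneg n) (hle1 k)
    simp only [tailCount, h1]
    rw [Fin.card_filter_val_lt, min_eq_right h2]
  have hlower : ∀ (n k : ℕ), |(n : ℝ)⁻¹ * ⌊n * μ.tailVec k⌋₊ - μ.tailVec k| ≤ μ.tailVec k := by
    intro n k
    have h1 : (n : ℝ)⁻¹ * ⌊n * μ.tailVec k⌋₊ ≤ μ.tailVec k := by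
      rcases Nat.eq_zero_or_pos n with rfl | hn
      · simpa using hnn k
      · rw [inv_mul_le_iff₀ (by positivity)]
        exact Nat.floor_le (by have := hnn k; positivity)
    rw [abs_of_nonpos (by linarith)]
    have : 0 ≤ (n : ℝ)⁻¹ * ⌊n * μ.tailVec k⌋₊ := by positivity
    linarith
  rw [TailsTendsto, tendsto_iff_norm_sub_tendsto_zero]
  have hnorm : ∀ n : ℕ, ‖(n : ℝ)⁻¹ • tailVec (fun i : Fin n => Nat.find (hex n i)) - μ.tailVec‖ =
      ∑' k, |(n : ℝ)⁻¹ * ⌊n * μ.tailVec k⌋₊ - μ.tailVec k| := by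
    intro n
    rw [lp_one_norm_eq]
    refine tsum_congr fun k => ?_
    rw [lp.coeFn_sub, Pi.sub_apply, lp.coeFn_smul, Pi.smul_apply, tailVec_apply, hcount,
      smul_eq_mul]
  simp only [hnorm]
  rw [← tsum_zero (β := ℕ) (α := ℝ)]
  refine tendsto_tsum_of_dominated_convergence (lp_one_summable μ.tailVec).of_abs (fun k => ?_)
    (Eventually.of_forall fun n k => by rw [Real.norm_eq_abs, abs_abs]; exact hlower n k)
  have h1 : Tendsto (fun n : ℕ => (⌊μ.tailVec k * n⌋₊ : ℝ) / n) atTop (𝓝 (μ.tailVec k)) :=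
    (tendsto_nat_floor_mul_div_atTop (hnn k)).comp tendsto_natCast_atTop_atTop
  have h2 := (h1.sub_const (μ.tailVec k)).abs
  rw [sub_self, abs_zero] at h2
  refine h2.congr fun n => ?_
  rw [mul_comm, div_eq_inv_mul]

/-! ### The Fekete argument and the limit functional -/

theorem exists_tendsto_of_eventually_almost_increasing {x : ℕ → ℝ} {B : ℝ}
    (hB : ∀ᶠ n in atTop, |x n| ≤ B)
    (h : ∀ η > 0, ∀ᶠ m in atTop, ∀ᶠ n in atTop, x m - η ≤ x n) :
    ∃ l, Tendsto x atTop (𝓝 l) := by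
  have hle : IsBoundedUnder (· ≤ ·) atTop x :=
    ⟨B, eventually_map.2 (hB.mono fun n hn => (abs_le.1 hn).2)⟩
  have hge : IsBoundedUnder (· ≥ ·) atTop x :=
    ⟨-B, eventually_map.2 (hB.mono fun n hn => (abs_le.1 hn).1)⟩
  refine ⟨liminf x atTop, tendsto_of_le_liminf_of_limsup_le le_rfl ?_ hle hge⟩
  refine le_of_forall_pos_le_add fun η hη => ?_
  refine limsup_le_of_le hge.isCoboundedUnder_le ?_
  filter_upwards [h η hη] with m hm
  have := le_liminf_of_le hle.isCoboundedUnder_ge hm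
  linarith

theorem tendsto_natDiv_div (m : ℕ) :
    Tendsto (fun n : ℕ => ((n / m : ℕ) : ℝ) / n) atTop (𝓝 (m : ℝ)⁻¹) := by
  have h1 : Tendsto (fun n : ℕ => (⌊(m : ℝ)⁻¹ * n⌋₊ : ℝ) / n) atTop (𝓝 (m : ℝ)⁻¹) :=
    (tendsto_nat_floor_mul_div_atTop (by positivity)).comp tendsto_natCast_atTop_atTop
  refine h1.congr fun n => ?_
  rw [inv_mul_eq_div, Nat.floor_div_eq_div]

namespace GraphParameter

variable {f : GraphParameter} {κ : ℝ}

/-- Fill n vertices with ⌊n/m⌋ copies of `d₀` and isolated vertices, then pass to `d n` by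
stability; the distance between the tails tends to that of `μ` from the normalized tails of `d₀`. -/
theorem exists_eventually_le_meanVal (hadd : f.IsAdditive) (hf : f.IsLipschitz κ)
    (hconc : f.IsConcave) {ε : ℝ} (hε : 0 < ε) : ∃ C, 0 ≤ C ∧
      ∀ {d : ∀ n : ℕ, Fin n → ℕ} {μ : P1}, TailsTendsto d μ → ∀ {m : ℕ}, 0 < m → ∀ (d₀ : Fin m → ℕ)
        {η : ℝ}, 0 < η → ∀ᶠ n in atTop,
          f.meanVal d₀ / m - κ * (ε * ‖(m : ℝ)⁻¹ • tailVec d₀‖ + C / m) -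
            2 * κ * ‖μ.tailVec - (m : ℝ)⁻¹ • tailVec d₀‖ - η ≤ f.meanVal (d n) / n := by
  obtain ⟨C, hC, h⟩ := exists_copies hadd hf hconc hε
  refine ⟨C, hC, fun {d μ} hd {m} hm d₀ {η} hη => ?_⟩
  set c := f.val (⟨0⟩ : Multigraph (Fin 1)) with hc
  set A := f.meanVal d₀ - κ * (ε * ‖tailVec d₀‖ + C) with hA
  have key : ∀ n : ℕ, 0 < n → ((n / m : ℕ) : ℝ) / n * A - (m * |c| + κ * C) / n -
      2 * κ * ‖(n : ℝ)⁻¹ • tailVec (d n) - (((n / m : ℕ) : ℝ) / n) • tailVec d₀‖ ≤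
        f.meanVal (d n) / n := by
    intro n hn
    have hn' : (0 : ℝ) < n := by exact_mod_cast hn
    obtain ⟨e, he, hfe⟩ := h m (n / m) (n % m) n (by rw [mul_comm]; exact (Nat.div_add_mod n m).symm) d₀
    have h1 := (abs_le.1 (hf.abs_meanVal_sub_le (d n) e)).1
    have h2 : -(m * |c|) ≤ ((n % m : ℕ) : ℝ) * c := by
      have h3 : ((n % m : ℕ) : ℝ) ≤ m := by exact_mod_cast (Nat.mod_lt n hm).le
      have h4 : ((n % m : ℕ) : ℝ) * |c| ≤ m * |c| := mul_le_mul_of_nonneg_right h3 (abs_nonneg _)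
      have h5 : ((n % m : ℕ) : ℝ) * -|c| ≤ ((n % m : ℕ) : ℝ) * c :=
        mul_le_mul_of_nonneg_left (neg_abs_le c) (Nat.cast_nonneg _)
      linarith
    have h6 : ‖(n : ℝ)⁻¹ • tailVec (d n) - (((n / m : ℕ) : ℝ) / n) • tailVec d₀‖ =
        ‖tailVec (d n) - tailVec e‖ / n := by
      rw [he, div_eq_inv_mul, mul_smul, ← smul_sub, norm_smul, Real.norm_of_nonneg (by positivity),
        ← div_eq_inv_mul]
    rw [h6, le_div_iff₀ hn']
    have h7 : (((n / m : ℕ) : ℝ) / n * A - (m * |c| + κ * C) / n -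
        2 * κ * (‖tailVec (d n) - tailVec e‖ / n)) * n =
        ((n / m : ℕ) : ℝ) * A - (m * |c| + κ * C) - 2 * κ * ‖tailVec (d n) - tailVec e‖ := by
      field_simp
    rw [h7]
    linarith
  have hlim : Tendsto (fun n : ℕ => ((n / m : ℕ) : ℝ) / n * A - (m * |c| + κ * C) / n -
      2 * κ * ‖(n : ℝ)⁻¹ • tailVec (d n) - (((n / m : ℕ) : ℝ) / n) • tailVec d₀‖) atTop
      (𝓝 ((m : ℝ)⁻¹ * A - 0 - 2 * κ * ‖μ.tailVec - (m : ℝ)⁻¹ • tailVec d₀‖)) :=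
    (((tendsto_natDiv_div m).mul_const A).sub (tendsto_const_div_atTop_nhds_zero_nat _)).sub
      ((hd.sub ((tendsto_natDiv_div m).smul_const _)).norm.const_mul _)
  have hev := hlim.eventually (lt_mem_nhds (sub_lt_self _ hη))
  filter_upwards [hev, eventually_gt_atTop 0] with n h1 hn
  refine le_trans (le_of_eq ?_) (h1.le.trans (key n hn))
  rw [hA, norm_smul, Real.norm_of_nonneg (by positivity : (0 : ℝ) ≤ (m : ℝ)⁻¹)]
  field_simp
  ring

theorem abs_meanVal_le (hadd : f.IsAdditive) (hf : f.IsLipschitz κ) {n : ℕ} (d : Fin n → ℕ) :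
    |f.meanVal d| ≤ 2 * κ * ‖tailVec d‖ + n * |f.val (⟨0⟩ : Multigraph (Fin 1))| := by
  have h1 := hf.abs_meanVal_sub_le d 0
  rw [meanVal_zero hadd, tailVec_zero, sub_zero] at h1
  have h2 : |(n : ℝ) * f.val (⟨0⟩ : Multigraph (Fin 1))| =
      n * |f.val (⟨0⟩ : Multigraph (Fin 1))| := by rw [abs_mul, Nat.abs_cast]
  have h3 := abs_sub_abs_le_abs_sub (f.meanVal d) (n * f.val (⟨0⟩ : Multigraph (Fin 1)))
  linarith

theorem exists_tendsto_meanVal_div (hadd : f.IsAdditive) (hf : f.IsLipschitz κ)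
    (hconc : f.IsConcave) {d : ∀ n : ℕ, Fin n → ℕ} {μ : P1} (hd : TailsTendsto d μ) :
    ∃ l, Tendsto (fun n : ℕ => f.meanVal (d n) / n) atTop (𝓝 l) := by
  have hκ := hf.nonneg
  have hnorm : Tendsto (fun n : ℕ => ‖(n : ℝ)⁻¹ • tailVec (d n)‖) atTop (𝓝 ‖μ.tailVec‖) := hd.norm
  refine exists_tendsto_of_eventually_almost_increasing
    (B := 2 * κ * (‖μ.tailVec‖ + 1) + |f.val (⟨0⟩ : Multigraph (Fin 1))|) ?_ fun η hη => ?_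
  · filter_upwards [hnorm.eventually (gt_mem_nhds (lt_add_one _)), eventually_gt_atTop 0]
      with n h1 hn
    have hn' : (0 : ℝ) < n := by exact_mod_cast hn
    rw [abs_div, Nat.abs_cast, div_le_iff₀ hn']
    refine (abs_meanVal_le hadd hf (d n)).trans ?_
    rw [norm_smul, Real.norm_of_nonneg (by positivity), inv_mul_lt_iff₀ hn'] at h1
    have := mul_le_mul_of_nonneg_left h1.le (by positivity : 0 ≤ 2 * κ)
    linarith
  -- Chosen so that κε‖μ‖ ≤ η/4; the added 1 keeps the denominator positive when κ or the mean
  -- vanishes.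
  · have hε : 0 < η / (4 * (κ * ‖μ.tailVec‖ + 1)) := by positivity
    obtain ⟨C, hC, h⟩ := exists_eventually_le_meanVal hadd hf hconc hε
    set ε := η / (4 * (κ * ‖μ.tailVec‖ + 1)) with hεdef
    have hlim : Tendsto (fun m : ℕ => κ * (ε * ‖(m : ℝ)⁻¹ • tailVec (d m)‖ + C / m) +
        2 * κ * ‖μ.tailVec - (m : ℝ)⁻¹ • tailVec (d m)‖) atTop
        (𝓝 (κ * (ε * ‖μ.tailVec‖ + 0) + 2 * κ * ‖μ.tailVec - μ.tailVec‖)) :=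
      (((hnorm.const_mul ε).add (tendsto_const_div_atTop_nhds_zero_nat C)).const_mul κ).add
        ((hd.const_sub μ.tailVec).norm.const_mul (2 * κ))
    have hlt : κ * (ε * ‖μ.tailVec‖ + 0) + 2 * κ * ‖μ.tailVec - μ.tailVec‖ < η / 2 := by
      rw [sub_self, norm_zero, mul_zero, add_zero, add_zero]
      have e1 : κ * (ε * ‖μ.tailVec‖) = η / 4 * (κ * ‖μ.tailVec‖ / (κ * ‖μ.tailVec‖ + 1)) := by
        rw [hεdef]; field_simp
      have e2 : κ * ‖μ.tailVec‖ / (κ * ‖μ.tailVec‖ + 1) ≤ 1 := by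
        rw [div_le_one₀ (by positivity)]; linarith
      rw [e1]
      nlinarith
    filter_upwards [hlim.eventually (gt_mem_nhds hlt), eventually_gt_atTop 0] with m hm hm0
    filter_upwards [h hd hm0 (d m) (half_pos hη)] with n hn
    linarith

/-- The limit of the normalized mean along any degree sequences whose tails tend to those
of `μ`. -/
def limitVal (f : GraphParameter) (μ : P1) : ℝ :=
  limUnder atTop fun n : ℕ => f.meanVal ((exists_tailsTendsto μ).choose n) / n

/-- By stability, two sequences with the same tail limit have means that differ by o(n), so the
reference sequence in `limitVal` is immaterial. -/
theorem tendsto_meanVal_div (hadd : f.IsAdditive) (hf : f.IsLipschitz κ)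
    (hconc : f.IsConcave) {d : ∀ n : ℕ, Fin n → ℕ} {μ : P1} (hd : TailsTendsto d μ) :
    Tendsto (fun n : ℕ => f.meanVal (d n) / n) atTop (𝓝 (f.limitVal μ)) := by
  have hd₀ := (exists_tailsTendsto μ).choose_spec
  set d₀ := (exists_tailsTendsto μ).choose
  have h0 : Tendsto (fun n : ℕ => f.meanVal (d₀ n) / n) atTop (𝓝 (f.limitVal μ)) :=
    tendsto_nhds_limUnder (exists_tendsto_meanVal_div hadd hf hconc hd₀)
  have h1 : Tendsto (fun n : ℕ => 2 * κ * ‖(n : ℝ)⁻¹ • tailVec (d n) -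
      (n : ℝ)⁻¹ • tailVec (d₀ n)‖) atTop (𝓝 0) := by
    have := (hd.sub hd₀).norm.const_mul (2 * κ)
    rwa [sub_self, norm_zero, mul_zero] at this
  have h2 : Tendsto (fun n : ℕ => f.meanVal (d n) / n - f.meanVal (d₀ n) / n) atTop (𝓝 0) := by
    refine squeeze_zero_norm (fun n => ?_) h1
    rw [← sub_div, norm_div, Real.norm_natCast, Real.norm_eq_abs, ← smul_sub, norm_smul,
      Real.norm_of_nonneg (by positivity : (0 : ℝ) ≤ (n : ℝ)⁻¹), div_eq_inv_mul]
    calc (n : ℝ)⁻¹ * |f.meanVal (d n) - f.meanVal (d₀ n)|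
        ≤ (n : ℝ)⁻¹ * (2 * κ * ‖tailVec (d n) - tailVec (d₀ n)‖) :=
          mul_le_mul_of_nonneg_left (hf.abs_meanVal_sub_le _ _) (by positivity)
      _ = _ := by ring
  simpa using h2.add h0

theorem abs_limitVal_sub_le (hadd : f.IsAdditive) (hf : f.IsLipschitz κ) (hconc : f.IsConcave)
    (μ μ' : P1) : |f.limitVal μ - f.limitVal μ'| ≤ 2 * κ * P1.wasserstein μ μ' := by
  obtain ⟨d, hd⟩ := exists_tailsTendsto μ
  obtain ⟨d', hd'⟩ := exists_tailsTendsto μ'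
  rw [P1.wasserstein_eq]
  refine le_of_tendsto_of_tendsto' ((tendsto_meanVal_div hadd hf hconc hd).sub
    (tendsto_meanVal_div hadd hf hconc hd')).abs ((hd.sub hd').norm.const_mul (2 * κ)) fun n => ?_
  rw [← sub_div, abs_div, Nat.abs_cast, ← smul_sub, norm_smul,
    Real.norm_of_nonneg (by positivity : (0 : ℝ) ≤ (n : ℝ)⁻¹), div_eq_inv_mul]
  calc (n : ℝ)⁻¹ * |f.meanVal (d n) - f.meanVal (d' n)|
      ≤ (n : ℝ)⁻¹ * (2 * κ * ‖tailVec (d n) - tailVec (d' n)‖) :=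
        mul_le_mul_of_nonneg_left (hf.abs_meanVal_sub_le _ _) (by positivity)
    _ = _ := by ring

/-- Blocks of sizes ⌊θn⌋ and n - ⌊θn⌋ for the two measures are concatenated. Both sizes must tend to
infinity, so θ is strictly between 0 and 1. -/
theorem limitVal_mix_of_mem_Ioo (hadd : f.IsAdditive) (hf : f.IsLipschitz κ)
    (hconc : f.IsConcave) {θ : ℝ} (h0 : 0 < θ) (h1 : θ < 1) (hθ : θ ∈ Set.Icc (0 : ℝ) 1)
    (μ μ' : P1) :
    θ * f.limitVal μ + (1 - θ) * f.limitVal μ' ≤ f.limitVal (P1.mix θ hθ μ μ') := by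
  obtain ⟨d, hd⟩ := exists_tailsTendsto μ
  obtain ⟨d', hd'⟩ := exists_tailsTendsto μ'
  have hκ := hf.nonneg
  set a : ℕ → ℕ := fun n => ⌊θ * n⌋₊ with ha
  set b : ℕ → ℕ := fun n => n - a n with hb
  have hab : ∀ n, n = a n + b n := fun n => by
    have : a n ≤ n := Nat.floor_le_of_le (mul_le_of_le_one_left (Nat.cast_nonneg n) h1.le)
    simp only [hb]; lia
  have hab' : ∀ n : ℕ, (n : ℝ) = a n + b n := fun n => by exact_mod_cast hab n
  have hlima : Tendsto (fun n : ℕ => (a n : ℝ) / n) atTop (𝓝 θ) :=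
    (tendsto_nat_floor_mul_div_atTop h0.le).comp tendsto_natCast_atTop_atTop
  have hlimb : Tendsto (fun n : ℕ => (b n : ℝ) / n) atTop (𝓝 (1 - θ)) := by
    refine (hlima.const_sub 1).congr' ?_
    filter_upwards [eventually_gt_atTop 0] with n hn
    have hn' : (n : ℝ) ≠ 0 := by positivity
    have := hab' n
    field_simp
    linarith
  have htop : ∀ (u : ℕ → ℕ) {t : ℝ}, 0 < t → Tendsto (fun n : ℕ => (u n : ℝ) / n) atTop (𝓝 t) →
      Tendsto u atTop atTop := by
    intro u t ht hu
    have := hu.pos_mul_atTop ht (tendsto_natCast_atTop_atTop (R := ℝ))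
    rw [← tendsto_natCast_atTop_iff (R := ℝ)]
    refine this.congr' ?_
    filter_upwards [eventually_gt_atTop 0] with n hn
    have hn' : (n : ℝ) ≠ 0 := by positivity
    field_simp
  have hatop := htop a h0 hlima
  have hbtop := htop b (sub_pos.2 h1) hlimb
  have hscale : ∀ (u : ℕ → ℕ) {t : ℝ} {E : Type} [NormedAddCommGroup E] [NormedSpace ℝ E]
      {x : ℕ → E} {y : E}, Tendsto u atTop atTop →
      Tendsto (fun n : ℕ => (u n : ℝ) / n) atTop (𝓝 t) →
      Tendsto (fun n : ℕ => (n : ℝ)⁻¹ • x n) atTop (𝓝 y) →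
      Tendsto (fun n : ℕ => (n : ℝ)⁻¹ • x (u n)) atTop (𝓝 (t • y)) := by
    intro u t E _ _ x y hu hut hx
    refine (hut.smul (hx.comp hu)).congr' ?_
    filter_upwards [hu.eventually (eventually_gt_atTop 0)] with n hn
    have hn' : (u n : ℝ) ≠ 0 := by positivity
    rw [Function.comp_apply, smul_smul]
    congr 1
    field_simp
  refine le_of_forall_pos_le_add fun η hη => ?_
  obtain ⟨C, hC, h⟩ := exists_concat hadd hf hconc
    (ε := η / (κ * ‖(1 - θ) • μ'.tailVec‖ + 1)) (by positivity)
  set ε := η / (κ * ‖(1 - θ) • μ'.tailVec‖ + 1) with hε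
  choose e he hfe using fun n => h (a n) (b n) n (hab n) (d (a n)) (d' (b n))
  have hTb := hscale b (x := fun n => tailVec (d' n)) hbtop hlimb hd'
  have hTe : TailsTendsto e (P1.mix θ hθ μ μ') := by
    rw [TailsTendsto, P1.tailVec_mix]
    simp only [he, smul_add]
    exact (hscale a (x := fun n => tailVec (d n)) hatop hlima hd).add hTb
  have hFe := tendsto_meanVal_div hadd hf hconc hTe
  have hFa := tendsto_meanVal_div hadd hf hconc hd
  have hFb := tendsto_meanVal_div hadd hf hconc hd'
  simp only [div_eq_inv_mul] at hFa hFb hFe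
  have hlow := ((hscale a hatop hlima hFa).add (hscale b hbtop hlimb hFb)).sub
    (((hTb.norm.const_mul ε).add (tendsto_const_div_atTop_nhds_zero_nat C)).const_mul κ)
  have hle := le_of_tendsto_of_tendsto' hlow hFe fun n => by
    have h2 := mul_le_mul_of_nonneg_left (hfe n) (by positivity : (0 : ℝ) ≤ (n : ℝ)⁻¹)
    refine le_trans (le_of_eq ?_) h2
    rw [norm_smul, Real.norm_of_nonneg (by positivity : (0 : ℝ) ≤ (n : ℝ)⁻¹)]
    simp only [smul_eq_mul, div_eq_inv_mul]
    ring
  have hfin : κ * (ε * ‖(1 - θ) • μ'.tailVec‖ + 0) ≤ η := by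
    have e1 : κ * (ε * ‖(1 - θ) • μ'.tailVec‖ + 0) =
        η * (κ * ‖(1 - θ) • μ'.tailVec‖ / (κ * ‖(1 - θ) • μ'.tailVec‖ + 1)) := by
      rw [hε]; field_simp; ring
    have e2 : κ * ‖(1 - θ) • μ'.tailVec‖ / (κ * ‖(1 - θ) • μ'.tailVec‖ + 1) ≤ 1 := by
      rw [div_le_one₀ (by positivity)]; linarith
    rw [e1]
    exact mul_le_of_le_one_right hη.le e2
  simp only [smul_eq_mul] at hle hfin
  linarith

theorem limitVal_mix (hadd : f.IsAdditive) (hf : f.IsLipschitz κ) (hconc : f.IsConcave)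
    (θ : ℝ) (hθ : θ ∈ Set.Icc (0 : ℝ) 1) (μ μ' : P1) :
    θ * f.limitVal μ + (1 - θ) * f.limitVal μ' ≤ f.limitVal (P1.mix θ hθ μ μ') := by
  have hext : ∀ ν ν' : P1, (ν.1 : Measure ℕ) = ν'.1 → ν = ν' := fun ν ν' h =>
    Subtype.ext (Subtype.ext h)
  rcases hθ.1.eq_or_lt with rfl | h0
  · have : P1.mix 0 hθ μ μ' = μ' := hext _ _ (by simp [P1.mix])
    rw [this]; simp
  rcases hθ.2.eq_or_lt with rfl | h1
  · have : P1.mix 1 hθ μ μ' = μ := hext _ _ (by simp [P1.mix])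
    rw [this]; simp
  exact limitVal_mix_of_mem_Ioo hadd hf hconc h0 h1 hθ μ μ'

end GraphParameter

/-! ### Almost sure convergence -/

theorem maximalMatchings_eq {V : Type} [Fintype V] (d : V → ℕ) :
    maximalMatchings d = fullMatchings (HalfEdge d) := by
  ext m
  rw [mem_fullMatchings, ← maximal_isPartialMatching_iff]
  simp [maximalMatchings]

namespace GraphParameter

variable {f : GraphParameter} {κ : ℝ}

/-- Chernoff's bound, with the exponential moments at l and -l for the two tails. -/
theorem IsLipschitz.configurationModel_deviation_le (hf : f.IsLipschitz κ) {V : Type} [Fintype V]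
    (d : V → ℕ) {l : ℝ} (hl : 0 ≤ l) (δ : ℝ) :
    (configurationModel d).toMeasure.real {G | δ ≤ |f.val G - f.meanVal d|} ≤
      2 * Real.exp (-(l * δ) + (∑ i, d i : ℕ) * (32 * l ^ 2 * κ ^ 2)) := by
  set g : Multiset (Sym2 (HalfEdge d)) → ℝ := fun P => f.val ⟨mapPairs Sigma.fst P⟩ with hg
  have hglip : IsPairLipschitz κ g :=
    hf.isPairLipschitz.comp_mapPairs (Sigma.fst (β := fun i => Fin (d i)))
  set S := fullMatchings (HalfEdge d) with hS
  have hSne : S.Nonempty := fullMatchings_nonempty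
  have hmeas : (configurationModel d).toMeasure.real {G | δ ≤ |f.val G - f.meanVal d|} =
      𝔼 m ∈ S, if δ ≤ |g m.val - matchAvg g| then (1 : ℝ) else 0 := by
    rw [Measure.real, PMF.toMeasure_apply_eq_toOuterMeasure_apply _ MeasurableSpace.measurableSet_top, configurationModel,
      PMF.toOuterMeasure_map_apply, PMF.toOuterMeasure_uniformOfFinset_apply, ENNReal.toReal_div,
      ENNReal.toReal_natCast, ENNReal.toReal_natCast, maximalMatchings_eq,
      Finset.expect_eq_sum_div_card, Finset.sum_boole]
    rfl
  have hpt : ∀ y : ℝ, (if δ ≤ |y| then (1 : ℝ) else 0) ≤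
      Real.exp (-(l * δ)) * (Real.exp (l * y) + Real.exp (-l * y)) := by
    intro y
    split_ifs with h
    · have h1 : Real.exp (l * |y|) ≤ Real.exp (l * y) + Real.exp (-l * y) := by
        rcases abs_cases y with ⟨h, -⟩ | ⟨h, -⟩ <;> rw [h]
        · linarith [Real.exp_pos (-l * y)]
        · rw [mul_neg, ← neg_mul]; linarith [Real.exp_pos (l * y)]
      calc (1 : ℝ) ≤ Real.exp (-(l * δ)) * Real.exp (l * |y|) := by
            rw [← Real.exp_add]
            refine Real.one_le_exp ?_
            have := mul_le_mul_of_nonneg_left h hl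
            linarith
        _ ≤ _ := by gcongr
    · positivity
  rw [hmeas]
  have h1 := matchAvg_exp_le hglip hf.nonneg l
  have h2 := matchAvg_exp_le hglip hf.nonneg (-l)
  rw [card_halfEdge] at h1 h2
  calc 𝔼 m ∈ S, (if δ ≤ |g m.val - matchAvg g| then (1 : ℝ) else 0)
      ≤ 𝔼 m ∈ S, Real.exp (-(l * δ)) * (Real.exp (l * (g m.val - matchAvg g)) +
          Real.exp (-l * (g m.val - matchAvg g))) := Finset.expect_le_expect fun m _ => hpt _
    _ = Real.exp (-(l * δ)) * (matchAvg (fun P => Real.exp (l * (g P - matchAvg g))) +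
          matchAvg (fun P => Real.exp (-l * (g P - matchAvg g)))) := by
        rw [← Finset.mul_expect, Finset.expect_add_distrib]; rfl
    _ ≤ Real.exp (-(l * δ)) * (Real.exp ((∑ i, d i : ℕ) * (32 * l ^ 2 * κ ^ 2)) +
          Real.exp ((∑ i, d i : ℕ) * (32 * (-l) ^ 2 * κ ^ 2))) := by gcongr
    _ = _ := by rw [Real.exp_add, neg_sq]; ring

theorem ae_eventually_abs_sub_lt (hf : f.IsLipschitz κ) {d : ∀ n : ℕ, Fin n → ℕ} {μ : P1}
    (hd : TailsTendsto d μ) {Ω : Type*} [MeasurableSpace Ω] {P : Measure Ω}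
    [IsProbabilityMeasure P] {G : ∀ n : ℕ, Ω → Multigraph (Fin n)}
    (hG : ∀ n, HasLaw (G n) (configurationModel (d n)).toMeasure P) {ε : ℝ} (hε : 0 < ε) :
    ∀ᵐ ω ∂P, ∀ᶠ n : ℕ in atTop, |f.val (G n ω) - f.meanVal (d n)| < ε * n := by
  set B : ℝ := ‖μ.tailVec‖ + 1 with hB
  have hBpos : 0 < B := by positivity
  -- This `l` keeps the quadratic term of the exponent below half of the linear one; the added 1
  -- covers κ = 0.
  set l : ℝ := ε / (64 * B * κ ^ 2 + 1) with hl
  have hlpos : 0 < l := by positivity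
  have hbound : ∀ᶠ n : ℕ in atTop, (∑ i, (d n i : ℝ)) ≤ B * n := by
    filter_upwards [hd.norm.eventually (gt_mem_nhds (lt_add_one _)), eventually_gt_atTop 0]
      with n h1 hn
    rw [norm_inv_smul_tailVec, div_lt_iff₀ (by positivity)] at h1
    exact h1.le
  have hprob : ∀ᶠ n : ℕ in atTop, ‖P.real {ω | ε * n ≤ |f.val (G n ω) - f.meanVal (d n)|}‖ ≤
      2 * Real.exp (-(l * ε / 2)) ^ n := by
    filter_upwards [hbound] with n hn
    rw [Real.norm_of_nonneg measureReal_nonneg,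
      (hG n).measureReal_eq (p := fun H => ε * n ≤ |f.val H - f.meanVal (d n)|) trivial]
    refine (hf.configurationModel_deviation_le (d n) hlpos.le _).trans ?_
    rw [← Real.exp_nat_mul]
    gcongr
    push_cast
    have h1 : l * (64 * B * κ ^ 2) ≤ ε := by
      rw [hl, div_mul_eq_mul_div, div_le_iff₀ (by positivity)]
      nlinarith
    have h2 : (∑ i, (d n i : ℝ)) * (32 * l ^ 2 * κ ^ 2) ≤ B * n * (32 * l ^ 2 * κ ^ 2) := by
      gcongr
    have h3 : B * n * (32 * l ^ 2 * κ ^ 2) ≤ l * n / 2 * ε := by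
      calc B * n * (32 * l ^ 2 * κ ^ 2) = l * n / 2 * (l * (64 * B * κ ^ 2)) := by ring
        _ ≤ _ := by gcongr
    linarith
  have hsum : Summable fun n : ℕ =>
      P.real {ω | ε * n ≤ |f.val (G n ω) - f.meanVal (d n)|} := by
    refine Summable.of_norm_bounded_eventually_nat
      ((summable_geometric_of_lt_one (Real.exp_nonneg _) ?_).mul_left 2) hprob
    rw [Real.exp_lt_one_iff]
    have : 0 < l * ε := by positivity
    linarith
  -- The first Borel–Cantelli lemma uses the marginal laws only, so the joint law may be arbitrary.
  have hne : ∑' n : ℕ, P {ω | ε * n ≤ |f.val (G n ω) - f.meanVal (d n)|} ≠ ⊤ := by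
    have := hsum.tsum_ofReal_ne_top
    rwa [tsum_congr fun n => ofReal_measureReal (measure_ne_top P _)] at this
  filter_upwards [ae_eventually_notMem hne] with ω hω
  filter_upwards [hω] with n hn
  exact not_le.1 hn

theorem ae_tendsto_val_div (hadd : f.IsAdditive) (hf : f.IsLipschitz κ) (hconc : f.IsConcave)
    {d : ∀ n : ℕ, Fin n → ℕ} {μ : P1} (hd : TailsTendsto d μ) {Ω : Type*} [MeasurableSpace Ω]
    {P : Measure Ω} [IsProbabilityMeasure P] {G : ∀ n : ℕ, Ω → Multigraph (Fin n)}
    (hG : ∀ n, HasLaw (G n) (configurationModel (d n)).toMeasure P) :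
    ∀ᵐ ω ∂P, Tendsto (fun n : ℕ => f.val (G n ω) / n) atTop (𝓝 (f.limitVal μ)) := by
  have h := ae_all_iff.2 fun j : ℕ =>
    ae_eventually_abs_sub_lt hf hd hG (Nat.one_div_pos_of_nat (α := ℝ) (n := j))
  filter_upwards [h] with ω hω
  have h1 : Tendsto (fun n : ℕ => f.val (G n ω) / n - f.meanVal (d n) / n) atTop (𝓝 0) := by
    refine Metric.tendsto_nhds.2 fun ε hε => ?_
    obtain ⟨j, hj⟩ := exists_nat_one_div_lt hε
    filter_upwards [hω j, eventually_gt_atTop 0] with n hn hn0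
    have hn' : (0 : ℝ) < n := by exact_mod_cast hn0
    rw [Real.dist_eq, sub_zero, ← sub_div, abs_div, Nat.abs_cast, div_lt_iff₀ hn']
    exact hn.trans (mul_lt_mul_of_pos_right hj hn')
  simpa using h1.add (tendsto_meanVal_div hadd hf hconc hd)

end GraphParameter
end

theorem theorem1 (f : GraphParameter) (κ : ℝ)
    (hadd : f.IsAdditive) (hlip : f.IsLipschitz κ) (hconc : f.IsConcave) :
    ∃ Ψ : P1 → ℝ,
      (∀ (μ : P1) (d : ∀ n : ℕ, Fin n → ℕ), Approaches d μ →
        ∀ (Ω : Type*) [MeasurableSpace Ω] (P : Measure Ω) [IsProbabilityMeasure P]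
          (G : ∀ n : ℕ, Ω → Multigraph (Fin n)),
          (∀ n, HasLaw (G n) (configurationModel (d n)).toMeasure P) →
          ∀ᵐ ω ∂P, Tendsto (fun n : ℕ => f.val (G n ω) / n) atTop (𝓝 (Ψ μ))) ∧
      (∀ μ μ' : P1, |Ψ μ - Ψ μ'| ≤ 2 * κ * P1.wasserstein μ μ') ∧
      (∀ (θ : ℝ) (hθ : θ ∈ Set.Icc (0 : ℝ) 1) (μ μ' : P1),
        θ * Ψ μ + (1 - θ) * Ψ μ' ≤ Ψ (P1.mix θ hθ μ μ')) :=
  ⟨f.limitVal,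
    fun _ _ hd _ _ _ _ _ hG => GraphParameter.ae_tendsto_val_div hadd hlip hconc hd.tailsTendsto hG,
    GraphParameter.abs_limitVal_sub_le hadd hlip hconc,
    GraphParameter.limitVal_mix hadd hlip hconc⟩
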